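/- Let $\mathcal X=\mathbb R^{d_1}$, let $\mathcal P_{\mathcal X}$ be a probability distribution on $\mathcal X$, and let $c:\mathcal X\to[K]$ be a measurable clustering rule. For $N\ge 1$, inputs $x_1,\dots,x_N$ are drawn i.i.d. from $\mathcal P_{\mathcal X}$ and labelled $y_i=c(x_i)$; write $S=\{(x_i,y_i)\}_{i=1}^N$ and let $\mathcal P$ be the law of $(x,c(x))$, $x\sim\mathcal P_{\mathcal X}$. A downstream data set $\{(\tilde x_i,\tilde y_i)\}_{i=1}^{\tilde N}$ is drawn i.i.d. from a probability distribution $\tilde{\mathcal P}$ on $\mathcal X\times[\tilde K]$. Let $\mathcal H$ be a non-empty class of measurable feature extractors $h:\mathbb R^{d_1}\to\mathbb R^{d_2}$, $\mathcal F$ a non-empty class of measurable pre-training classifiers $f:\mathbb R^{d_2}\to\mathbb R^{K}$, and $\tilde{\mathcal F}$ a class of measurable downstream classifiers $f:\mathbb R^{d_2}\to\mathbb R^{\tilde K}$; suprema over $\mathcal F\circ\mathcal H$ of weighted sums of losses over a sample are assumed measurable. Let $\ell(v,y)=-\log\big(e^{v_y}/\sum_i e^{v_i}\big)$ be the cross-entropy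 loss and let $L_\ell$ be a Lipschitz constant of $\ell(\cdot,y):\mathbb R^K\to\mathbb R$ in the Euclidean norm, for every $y\in[K]$. Define (minima being understood as infima) $$\mathcal R_p(h)=\min_{f\in\mathcal F}\mathbb E_{S}\frac1N\sum_{i=1}^N\ell(f\circ h(x_i),y_i),\qquad \mathcal E_p(h)=\mathcal R_p(h)-\min_{h'\in\mathcal H}\mathcal R_p(h'),$$ $$\mathcal R_d(h)=\min_{f\in\tilde{\mathcal F}}\mathbb E\sum_{i=1}^{\tilde N}\ell(f\circ h(\tilde x_i),\tilde y_i),\qquad \mathcal E_d(h)=\mathcal R_d(h)-\min_{h'\in\mathcal H}\mathcal R_d(h'),$$ and let $\hat h_S\in\arg\min_{h\in\mathcal H}\min_{f\in\mathcal F}\sum_{i=1}^N\ell(f\circ h(x_i),y_i)$ be any empirical risk minimizer. Assume: (1) there is $M_\ell>0$ with $\ell(f\circ h(x),i)\le M_\ell$ for all $i\in[K]$, $f\in\mathcal F$, $h\in\mathcal H$, $x\in\mathcal X$, and there is a constant $G$, independent of $n$, with $$\mathbb E_{x_1,\dots,x_n\sim\mathcal P_{\mathcal X}}\,\mathbb E_{\sigma}\sup_{f\in\mathcal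 F,h\in\mathcal H}\sum_{i=1}^n\sum_{j=1}^K\sigma_{i,j}f_j\circ h(x_i)\le G\sqrt n\quad\text{for every } n\ge1,$$ where the $\sigma_{i,j}$ are independent standard Gaussians; (2) there are non-negative constants $\nu_0(\mathcal P),\nu_1(\mathcal P)$ with $\mathcal E_d(h)\le\nu_1(\mathcal P)\,\mathcal E_p(h)+\nu_0(\mathcal P)$ for all $h\in\mathcal H$, and constants $\nu_0(\mathcal P_{\mathcal X}),\nu_1(\mathcal P_{\mathcal X}),C_0,C_1$ with $|\nu_i(\mathcal P)-\nu_i(\mathcal P_{\mathcal X})|\le C_i/\sqrt K$ for $i=0,1$. Then, for every $\delta\in(0,1)$, with probability at least $1-\delta$ over the sample, $$\mathcal E_d(\hat h_S)\le\Big(\nu_1(\mathcal P_{\mathcal X})+\frac{C_1}{\sqrt K}\Big)\Big(5M_\ell\sqrt{\frac{\log\frac2\delta}{2N}}+\frac{2GL_\ell}{\sqrt N}\Big)+\nu_0(\mathcal P_{\mathcal X})+\frac{C_0}{\sqrt K}.$$ Moreover the right-hand side, as a function of $K\ge1$ with all other quantities fixed, is non-increasing: there is no trade-off in the number of classes. 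-/

import Mathlib

open MeasureTheory ProbabilityTheory
open scoped ENNReal NNReal

namespace PretrainDiversity

noncomputable section

/-- The cross-entropy loss `ℓ(v, y) = - log (e^{v_y} / ∑ i, e^{v_i})` of the scores `v ∈ ℝ^K`
at the label `y ∈ [K]`. -/
def crossEntropy {K : ℕ} (v : EuclideanSpace ℝ (Fin K)) (y : Fin K) : ℝ :=
  -Real.log (Real.exp (v y) / ∑ i, Real.exp (v i))

/-- A labelled data set of size `n`: inputs in `ℝ^d` with labels in `[K]`. -/
abbrev Dataset (d K n : ℕ) : Type :=
  Fin n → EuclideanSpace ℝ (Fin d) × Fin K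

/-- The total loss of the model `f ∘ h` over a data set. -/
def totalLoss {d₁ d₂ K n : ℕ}
    (f : EuclideanSpace ℝ (Fin d₂) → EuclideanSpace ℝ (Fin K))
    (h : EuclideanSpace ℝ (Fin d₁) → EuclideanSpace ℝ (Fin d₂)) (S : Dataset d₁ K n) : ℝ :=
  ∑ i, crossEntropy (f (h (S i).1)) (S i).2

/-- `h` is an empirical risk minimising feature extractor over the data set `S`:
`h ∈ argmin_{h ∈ H} min_{f ∈ F} ∑ i, ℓ (f ∘ h (x_i), y_i)`. -/
def IsERM {d₁ d₂ K n : ℕ}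
    (F : Set (EuclideanSpace ℝ (Fin d₂) → EuclideanSpace ℝ (Fin K)))
    (H : Set (EuclideanSpace ℝ (Fin d₁) → EuclideanSpace ℝ (Fin d₂)))
    (S : Dataset d₁ K n) (h : EuclideanSpace ℝ (Fin d₁) → EuclideanSpace ℝ (Fin d₂)) : Prop :=
  h ∈ H ∧ IsMinOn (fun h' => ⨅ f : F, totalLoss f.1 h' S) H h

/-- The pre-training risk `R_p(h, P) = min_{f ∈ F} E_{S ∼ P^N} (1/N) ∑ i, ℓ (f ∘ h (x_i), y_i)`.
The loss is nonnegative, so its expectation is taken in `[0, ∞]`. -/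
def pretrainRisk {d₁ d₂ K : ℕ} (N : ℕ)
    (F : Set (EuclideanSpace ℝ (Fin d₂) → EuclideanSpace ℝ (Fin K)))
    (P : Measure (EuclideanSpace ℝ (Fin d₁) × Fin K))
    (h : EuclideanSpace ℝ (Fin d₁) → EuclideanSpace ℝ (Fin d₂)) : ℝ≥0∞ :=
  ⨅ f ∈ F, ∫⁻ S : Dataset d₁ K N, ENNReal.ofReal (totalLoss f h S / N) ∂(Measure.pi fun _ => P)

/-- The pre-training representation error `E_p(h, P) = R_p(h, P) - min_{h' ∈ H} R_p(h', P)`. -/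
def pretrainError {d₁ d₂ K : ℕ} (N : ℕ)
    (F : Set (EuclideanSpace ℝ (Fin d₂) → EuclideanSpace ℝ (Fin K)))
    (H : Set (EuclideanSpace ℝ (Fin d₁) → EuclideanSpace ℝ (Fin d₂)))
    (P : Measure (EuclideanSpace ℝ (Fin d₁) × Fin K))
    (h : EuclideanSpace ℝ (Fin d₁) → EuclideanSpace ℝ (Fin d₂)) : ℝ≥0∞ :=
  pretrainRisk N F P h - ⨅ h' ∈ H, pretrainRisk N F P h'

/-- The downstream risk `R_d(h) = min_{f ∈ F} E_{S ∼ P^N} ∑ i, ℓ (f ∘ h (x_i), y_i)`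
(a sum over the downstream data set, not an average). -/
def downstreamRisk {d₁ d₂ K : ℕ} (N : ℕ)
    (F : Set (EuclideanSpace ℝ (Fin d₂) → EuclideanSpace ℝ (Fin K)))
    (P : Measure (EuclideanSpace ℝ (Fin d₁) × Fin K))
    (h : EuclideanSpace ℝ (Fin d₁) → EuclideanSpace ℝ (Fin d₂)) : ℝ≥0∞ :=
  ⨅ f ∈ F, ∫⁻ S : Dataset d₁ K N, ENNReal.ofReal (totalLoss f h S) ∂(Measure.pi fun _ => P)

/-- The downstream error `E_d(h) = R_d(h) - min_{h' ∈ H} R_d(h')`. -/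
def downstreamError {d₁ d₂ K : ℕ} (N : ℕ)
    (F : Set (EuclideanSpace ℝ (Fin d₂) → EuclideanSpace ℝ (Fin K)))
    (H : Set (EuclideanSpace ℝ (Fin d₁) → EuclideanSpace ℝ (Fin d₂)))
    (P : Measure (EuclideanSpace ℝ (Fin d₁) × Fin K))
    (h : EuclideanSpace ℝ (Fin d₁) → EuclideanSpace ℝ (Fin d₂)) : ℝ≥0∞ :=
  downstreamRisk N F P h - ⨅ h' ∈ H, downstreamRisk N F P h'

/-- The labelled data set obtained from the inputs `x_1, …, x_n` by the clustering rule `c`. -/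
def clusterDataset {d K n : ℕ} (c : EuclideanSpace ℝ (Fin d) → Fin K)
    (x : Fin n → EuclideanSpace ℝ (Fin d)) : Dataset d K n :=
  fun i => (x i, c (x i))

/-- The law of a labelled example `(x, c x)` with `x ∼ PX`. -/
def clusterLaw {d K : ℕ} (PX : Measure (EuclideanSpace ℝ (Fin d)))
    (c : EuclideanSpace ℝ (Fin d) → Fin K) : Measure (EuclideanSpace ℝ (Fin d) × Fin K) :=
  PX.map fun x => (x, c x)

/-- The expectation `E X⁺ - E X⁻` of a random variable with values in `[-∞, ∞]`. -/
def expectation {Ω : Type*} [MeasurableSpace Ω] (μ : Measure Ω) (X : Ω → EReal) : EReal :=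
  ((∫⁻ ω, (X ω).toENNReal ∂μ : ℝ≥0∞) : EReal) - ((∫⁻ ω, (-X ω).toENNReal ∂μ : ℝ≥0∞) : EReal)

/-- The Gaussian complexity of `F ∘ H` over `PX` with sample number `n`:
`E_{x ∼ PX^n} E_σ sup_{f ∈ F, h ∈ H} ∑ i, ∑ j, σ_{i,j} f_j ∘ h (x_i)` for independent standard
Gaussian `σ_{i,j}`, as an element of `[-∞, ∞]`. -/
def gaussianComplexity {d₁ d₂ K : ℕ} (n : ℕ)
    (F : Set (EuclideanSpace ℝ (Fin d₂) → EuclideanSpace ℝ (Fin K)))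
    (H : Set (EuclideanSpace ℝ (Fin d₁) → EuclideanSpace ℝ (Fin d₂)))
    (PX : Measure (EuclideanSpace ℝ (Fin d₁))) : EReal :=
  expectation (Measure.pi fun _ : Fin n => PX) fun x =>
    expectation (Measure.pi fun _ : Fin n => Measure.pi fun _ : Fin K => gaussianReal 0 1) fun σ =>
      ⨆ p : F × H, ((∑ i, ∑ j, σ i j * p.1.1 (p.2.1 (x i)) j : ℝ) : EReal)

/-- The usual measurability requirement on the class of losses in empirical process theory: its
members are measurable, and so are, up to null sets, the suprema over the class of the weighted
sums of losses over a sample. -/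
structure IsMeasurableClass {d₁ d₂ K : ℕ}
    (F : Set (EuclideanSpace ℝ (Fin d₂) → EuclideanSpace ℝ (Fin K)))
    (H : Set (EuclideanSpace ℝ (Fin d₁) → EuclideanSpace ℝ (Fin d₂)))
    (PX : Measure (EuclideanSpace ℝ (Fin d₁)))
    (c : EuclideanSpace ℝ (Fin d₁) → Fin K) : Prop where
  measurable_classifier : ∀ f ∈ F, Measurable f
  measurable_extractor : ∀ h ∈ H, Measurable h
  measurable_clustering : Measurable c
  aemeasurable_sup : ∀ (n : ℕ) (w : Fin n → ℝ),
    AEMeasurable (fun x : Fin n → EuclideanSpace ℝ (Fin d₁) =>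
      ⨆ p : F × H, ∑ i, w i * crossEntropy (p.1.1 (p.2.1 (x i))) (c (x i)))
      (Measure.pi fun _ => PX)

/-- The bound on the downstream error, as a function of the number `K` of clusters. -/
def errorBound (ν₀ ν₁ C₀ C₁ M L G δ : ℝ) (N K : ℕ) : ℝ :=
  (ν₁ + C₁ / √K) * (5 * M * √(Real.log (2 / δ) / (2 * N)) + 2 * G * L / √N) + ν₀ + C₀ / √K

end

end PretrainDiversity

open PretrainDiversity

/-! The core is a high-probability bound on the pre-training excess risk of an empirical risk
minimizer. The transfer assumption then passes it on, since each ν is at most its input-law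
counterpart plus C/√K.

For the excess risk, the sample is compared with an independent ghost sample of the same size. The
deviation between the two, maximal over the class and relative to a fixed reference model, involves
only a weighted supremum over 2N points, which is the kind of supremum assumed measurable. Bounded
differences control its fluctuations, and Jensen's inequality averages out the ghost sample
(`exists_measurableSet_integral_le_of_bounded_differences`). Subtracting the reference model inside
the deviation lets one event serve both the class and the reference
(`exists_measurableSet_excess_le`).

The mean of the deviation is an expected supremum with N signs of each kind. Swapping pairs with N
random signs would leave 2√(π/2)·GL/√N, more than the 2GL/√N allowed. Instead the balanced signs are
compared with 2N independent signs (`integral_halfSign_le_signAvg`), which gives √π·GL/√N plus a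
term of order M/√N. Signs become Gaussians through a contraction inequality
(`signAvg_iSup_le_integral_iSup_gaussian`) resting on ‖v‖ = √(π/2)·E|⟨g, v⟩|. The numerical slack of
`deviation_lt_bound` absorbs the M term and the fact that infima need not be attained. -/

namespace PretrainDiversity

/-! ### Gaussian vectors and their linear forms -/

/-- The law of a vector of `K` independent standard Gaussians. -/
noncomputable abbrev gaussianVector (K : ℕ) : Measure (Fin K → ℝ) :=
  Measure.pi fun _ : Fin K => gaussianReal 0 1

lemma integral_abs_gaussianReal : ∫ x, |x| ∂(gaussianReal 0 1) = √(2 / Real.pi) := by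
  rw [integral_gaussianReal_eq_integral_smul (by simp)]
  have h1 : ∀ x : ℝ, gaussianPDFReal 0 1 x • |x|
      = (fun y : ℝ => (√(2 * Real.pi))⁻¹ * (y ^ (1 : ℝ) * Real.exp (-(1 / 2) * y ^ (2 : ℝ)))) |x| := by
    intro x
    simp [gaussianPDFReal]
    ring_nf
  simp_rw [h1]
  rw [integral_comp_abs (f := fun y : ℝ =>
      (√(2 * Real.pi))⁻¹ * (y ^ (1 : ℝ) * Real.exp (-(1 / 2) * y ^ (2 : ℝ)))), integral_const_mul,
    integral_rpow_mul_exp_neg_mul_rpow (by norm_num) (by norm_num) (by norm_num)]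
  norm_num
  field_simp
  norm_num

lemma integrable_eval_gaussianVector {K : ℕ} (j : Fin K) :
    Integrable (fun g => g j) (gaussianVector K) :=
  integrable_eval IsGaussian.integrable_id

lemma integrable_linear_gaussianVector {K : ℕ} (v : EuclideanSpace ℝ (Fin K)) :
    Integrable (fun g => ∑ j, g j * v j) (gaussianVector K) :=
  integrable_finsetSum _ fun j _ => (integrable_eval_gaussianVector j).mul_const _

lemma integral_linear_gaussianVector {K : ℕ} (v : EuclideanSpace ℝ (Fin K)) :
    ∫ g, ∑ j, g j * v j ∂(gaussianVector K) = 0 := by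
  rw [integral_finsetSum _ fun j _ => (integrable_eval_gaussianVector j).mul_const _]
  refine Finset.sum_eq_zero fun j _ => ?_
  rw [integral_mul_const, integral_eval,
    integral_id_gaussianReal, zero_mul]

lemma measurePreserving_neg_gaussianVector (K : ℕ) :
    MeasurePreserving (fun g : Fin K → ℝ => -g) (gaussianVector K) (gaussianVector K) := by
  refine measurePreserving_pi (f := fun _ x => -x) _ _ fun i => ⟨measurable_neg, ?_⟩
  simpa using gaussianReal_map_neg (μ := 0) (v := 1)

/-- A linear form of a standard Gaussian vector is a centred Gaussian with standard deviation `‖v‖`.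
This writes a Euclidean norm as a Gaussian average, the source of the factor √(π/2) in the
contraction. -/
lemma integral_abs_linear_gaussianVector {K : ℕ} (v : EuclideanSpace ℝ (Fin K)) :
    ∫ g, |∑ j, g j * v j| ∂(gaussianVector K) = √(2 / Real.pi) * ‖v‖ := by
  have h1 : ∫ g, |∑ j, g j * v j| ∂(gaussianVector K)
      = ∫ x, |innerSL ℝ v x| ∂(stdGaussian (EuclideanSpace ℝ (Fin K))) := by
    rw [← map_pi_eq_stdGaussian, integral_map (by fun_prop) (by fun_prop)]
    simp [PiLp.inner_apply]
  have h2 : (stdGaussian (EuclideanSpace ℝ (Fin K))).map (innerSL ℝ v)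
      = (gaussianReal 0 1).map (fun x => ‖v‖ * x) := by
    rw [IsGaussian.map_eq_gaussianReal, variance_dual_stdGaussian,
      integral_strongDual_stdGaussian, innerSL_apply_norm, gaussianReal_map_const_mul]
    congr 1
    · simp
    · ext; simp
  have h3 : ∫ x, |innerSL ℝ v x| ∂(stdGaussian (EuclideanSpace ℝ (Fin K)))
      = ∫ y, |y| ∂((stdGaussian (EuclideanSpace ℝ (Fin K))).map (innerSL ℝ v)) := by
    rw [integral_map (by fun_prop) (by fun_prop)]
  rw [h1, h3, h2, integral_map (by fun_prop) (by fun_prop)]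
  simp_rw [abs_mul, abs_norm]
  rw [integral_const_mul, integral_abs_gaussianReal, mul_comm]

/-! ### Suprema of finite families -/

section FiniteSup

variable {ι : Type*} [Finite ι]

lemma bddAbove_range_of_finite (f : ι → ℝ) : BddAbove (Set.range f) :=
  (Set.finite_range f).bddAbove

lemma integrable_iSup_of_finite [Nonempty ι] {Ω : Type*} [MeasurableSpace Ω] {μ : Measure Ω}
    {f : ι → Ω → ℝ}
    (hf : ∀ t, Integrable (f t) μ) : Integrable (fun ω => ⨆ t, f t ω) μ := by
  have := Fintype.ofFinite ι
  refine Integrable.mono' (integrable_finsetSum Finset.univ fun t _ => (hf t).abs)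
    (AEMeasurable.iSup fun t => (hf t).aemeasurable).aestronglyMeasurable (ae_of_all _ fun ω => ?_)
  obtain ⟨t, ht⟩ := exists_eq_ciSup_of_finite (f := fun t => f t ω)
  rw [← ht, Real.norm_eq_abs]
  exact Finset.single_le_sum (f := fun t => |f t ω|) (fun t _ => abs_nonneg _) (Finset.mem_univ t)

end FiniteSup

/-! ### Averages over independent fair signs -/

/-- The sign `±1` coded by a Boolean. -/
noncomputable def boolSign (b : Bool) : ℝ := if b then 1 else -1

@[simp] lemma boolSign_true : boolSign true = 1 := rfl

@[simp] lemma boolSign_false : boolSign false = -1 := by simp [boolSign]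

/-- The expectation of `f ε` for `n` independent fair signs `ε`. -/
noncomputable def signAvg (n : ℕ) (f : (Fin n → Bool) → ℝ) : ℝ :=
  (∑ ε, f ε) / 2 ^ n

section signAvg

variable {n : ℕ}

lemma signAvg_zero (f : (Fin 0 → Bool) → ℝ) : signAvg 0 f = f default := by
  rw [signAvg, Fintype.sum_subsingleton _ default, pow_zero, div_one]

lemma signAvg_succ (f : (Fin (n + 1) → Bool) → ℝ) :
    signAvg (n + 1) f
      = signAvg n fun ε => (f (Fin.cons true ε) + f (Fin.cons false ε)) / 2 := by
  unfold signAvg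
  rw [← (Fin.consEquiv fun _ => Bool).sum_comp, Fintype.sum_prod_type, ← Finset.sum_div,
    Finset.sum_add_distrib, pow_succ', div_div]
  simp [Fin.consEquiv]

lemma signAvg_mono {f g : (Fin n → Bool) → ℝ} (h : ∀ ε, f ε ≤ g ε) :
    signAvg n f ≤ signAvg n g := by
  unfold signAvg
  gcongr
  exact h _

lemma signAvg_const (a : ℝ) : signAvg n (fun _ => a) = a := by
  simp [signAvg]

lemma signAvg_add (f g : (Fin n → Bool) → ℝ) :
    signAvg n (fun ε => f ε + g ε) = signAvg n f + signAvg n g := by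
  simp [signAvg, Finset.sum_add_distrib, add_div]

lemma signAvg_const_mul (a : ℝ) (f : (Fin n → Bool) → ℝ) :
    signAvg n (fun ε => a * f ε) = a * signAvg n f := by
  simp [signAvg, ← Finset.mul_sum, mul_div_assoc]

lemma integrable_signAvg {Ω : Type*} [MeasurableSpace Ω] {μ : Measure Ω}
    {f : (Fin n → Bool) → Ω → ℝ} (hf : ∀ ε, Integrable (f ε) μ) :
    Integrable (fun ω => signAvg n fun ε => f ε ω) μ :=
  (integrable_finsetSum _ fun ε _ => hf ε).div_const _

lemma integral_signAvg {Ω : Type*} [MeasurableSpace Ω] {μ : Measure Ω}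
    {f : (Fin n → Bool) → Ω → ℝ} (hf : ∀ ε, Integrable (f ε) μ) :
    ∫ ω, signAvg n (fun ε => f ε ω) ∂μ = signAvg n fun ε => ∫ ω, f ε ω ∂μ := by
  unfold signAvg
  rw [integral_div, integral_finsetSum _ fun ε _ => hf ε]

/-- Each sign has mean 0 and variance 1, so averaging over one more sign adds 1. -/
lemma signAvg_sum_sub_sq (b : ℝ) :
    signAvg n (fun ε => (∑ i, boolSign (ε i) - b) ^ 2) = n + b ^ 2 := by
  induction n generalizing b with
  | zero => simp [signAvg_zero]
  | succ n ih =>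
    rw [signAvg_succ]
    have h : ∀ ε : Fin n → Bool,
        ((∑ i, boolSign ((Fin.cons true ε : Fin (n + 1) → Bool) i) - b) ^ 2
          + (∑ i, boolSign ((Fin.cons false ε : Fin (n + 1) → Bool) i) - b) ^ 2) / 2
        = (∑ i, boolSign (ε i) - b) ^ 2 + 1 := by
      intro ε
      simp only [Fin.sum_univ_succ, Fin.cons_zero, Fin.cons_succ, boolSign_true, boolSign_false]
      ring
    simp_rw [h]
    rw [signAvg_add, ih, signAvg_const]
    push_cast
    ring

end signAvg

/-! ### Contraction from signs to Gaussians -/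

section Contraction

variable {ι : Type*} [Finite ι] [Nonempty ι] {K : ℕ}

/-- The Gaussian contraction inequality for a single fair sign. -/
lemma avg_iSup_le_integral_iSup_gaussian (A ψ : ι → ℝ) (v : ι → EuclideanSpace ℝ (Fin K)) {L : ℝ}
    (hL : 0 ≤ L) (hψ : ∀ s t, |ψ s - ψ t| ≤ L * ‖v s - v t‖) :
    ((⨆ t, (A t + ψ t)) + ⨆ t, (A t - ψ t)) / 2
      ≤ ∫ g, ⨆ t, (A t + L * √(Real.pi / 2) * ∑ j, g j * v t j) ∂(gaussianVector K) := by
  set a := L * √(Real.pi / 2) with ha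
  have ha0 : 0 ≤ a := by positivity
  have hU : Integrable (fun g => ⨆ t, (A t + a * ∑ j, g j * v t j)) (gaussianVector K) :=
    integrable_iSup_of_finite fun t =>
      (integrable_const _).add ((integrable_linear_gaussianVector (v t)).const_mul a)
  have hneg := measurePreserving_neg_gaussianVector K
  have hemb : MeasurableEmbedding (fun g : Fin K → ℝ => -g) :=
    (MeasurableEquiv.neg (Fin K → ℝ)).measurableEmbedding
  have hU' : Integrable (fun g : Fin K → ℝ => ⨆ t, (A t + a * ∑ j, (-g) j * v t j))
      (gaussianVector K) := (hneg.integrable_comp_emb hemb).2 hU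
  have hUU := hneg.integral_comp hemb fun g => ⨆ t, (A t + a * ∑ j, g j * v t j)
  -- Finiteness of the index set gives maximizers `s`, `t` of the two suprema. It remains to bound
  -- `ψ s - ψ t` by L times a norm, and that norm by a Gaussian average.
  obtain ⟨s, hs⟩ := exists_eq_ciSup_of_finite (f := fun t => A t + ψ t)
  obtain ⟨t, ht⟩ := exists_eq_ciSup_of_finite (f := fun t => A t - ψ t)
  rw [← hs, ← ht]
  have h1 : ψ s - ψ t ≤ a * ∫ g, |∑ j, g j * (v s - v t) j| ∂(gaussianVector K) := by
    rw [integral_abs_linear_gaussianVector, ha, mul_assoc, ← mul_assoc √_, ← Real.sqrt_mul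
      (by positivity)]
    have : Real.pi / 2 * (2 / Real.pi) = 1 := by field_simp
    rw [this, Real.sqrt_one, one_mul]
    exact (le_abs_self _).trans (hψ s t)
  have h2 : A s + A t + a * ∫ g, |∑ j, g j * (v s - v t) j| ∂(gaussianVector K)
      ≤ (∫ g, ⨆ t, (A t + a * ∑ j, g j * v t j) ∂(gaussianVector K))
        + ∫ g, ⨆ t, (A t + a * ∑ j, (-g) j * v t j) ∂(gaussianVector K) := by
    have hint := (integrable_linear_gaussianVector (v s - v t)).abs.const_mul a
    have h3 : A s + A t + a * ∫ g, |∑ j, g j * (v s - v t) j| ∂(gaussianVector K)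
        = ∫ g, (A s + A t + a * |∑ j, g j * (v s - v t) j|) ∂(gaussianVector K) := by
      rw [integral_add (integrable_const _) hint, integral_const_mul]
      simp
    rw [h3, ← integral_add hU hU']
    refine integral_mono ((integrable_const _).add hint) (hU.add hU') fun g => ?_
    have hle : ∀ (g : Fin K → ℝ) (t : ι), A t + a * ∑ j, g j * v t j
        ≤ ⨆ t, (A t + a * ∑ j, g j * v t j) := fun g t =>
      le_ciSup (f := fun t => A t + a * ∑ j, g j * v t j) (bddAbove_range_of_finite _) t
    have e1 : ∑ j, g j * (v s - v t) j = ∑ j, g j * v s j - ∑ j, g j * v t j := by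
      simp [mul_sub]
    have e2 : ∀ t, ∑ j, (-g) j * v t j = -∑ j, g j * v t j := fun t => by simp
    have i1 := hle g s
    have i2 := hle g t
    have i3 := hle (-g) s
    have i4 := hle (-g) t
    rw [e2] at i3 i4
    beta_reduce
    rw [e1]
    -- According to the sign of the difference, `s` competes at `g` and `t` at `-g`, or the reverse.
    -- The law of `g` is symmetric, so both suprema have the same mean.
    rcases abs_cases (∑ j, g j * v s j - ∑ j, g j * v t j) with ⟨h, -⟩ | ⟨h, -⟩ <;>
      rw [h] <;> linarith
  linarith

lemma integrable_gaussianProcess {n : ℕ} (A : ι → ℝ) (a : ℝ)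
    (v : Fin n → ι → EuclideanSpace ℝ (Fin K)) :
    Integrable (fun σ : Fin n → Fin K → ℝ => ⨆ t, (A t + a * ∑ i, ∑ j, σ i j * v i t j))
      (Measure.pi fun _ => gaussianVector K) :=
  integrable_iSup_of_finite fun t => (integrable_const _).add <| Integrable.const_mul
    (integrable_finsetSum _ fun i _ => integrable_comp_eval (μ := fun _ : Fin n => gaussianVector K)
      (f := fun g : Fin K → ℝ => ∑ j, g j * v i t j) (integrable_linear_gaussianVector (v i t))) _

/-- The vector contraction inequality, from fair signs to Gaussians. -/
theorem signAvg_iSup_le_integral_iSup_gaussian {n : ℕ} (A : ι → ℝ) (ψ : Fin n → ι → ℝ)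
    (v : Fin n → ι → EuclideanSpace ℝ (Fin K)) {L : ℝ} (hL : 0 ≤ L)
    (hψ : ∀ i s t, |ψ i s - ψ i t| ≤ L * ‖v i s - v i t‖) :
    signAvg n (fun ε => ⨆ t, (A t + ∑ i, boolSign (ε i) * ψ i t))
      ≤ ∫ σ : Fin n → Fin K → ℝ, ⨆ t, (A t + L * √(Real.pi / 2) * ∑ i, ∑ j, σ i j * v i t j)
          ∂(Measure.pi fun _ => gaussianVector K) := by
  -- The offset `A` must vary: it carries the other signed terms when one sign is replaced, and the
  -- Gaussian term already produced when the induction hypothesis is used.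
  induction n generalizing A with
  | zero => simp [signAvg_zero]
  | succ n ih =>
    set a := L * √(Real.pi / 2) with ha
    rw [signAvg_succ]
    have hmp := measurePreserving_piFinSuccAbove (fun _ : Fin (n + 1) => gaussianVector K) 0
    set B : (Fin n → Bool) → (Fin K → ℝ) → ℝ := fun ε g =>
      ⨆ t, ((A t + ∑ i, boolSign (ε i) * ψ i.succ t) + a * ∑ j, g j * v 0 t j) with hB
    have hBi : ∀ ε, Integrable (B ε) (gaussianVector K) := fun ε =>
      integrable_iSup_of_finite fun t =>
        (integrable_const _).add ((integrable_linear_gaussianVector (v 0 t)).const_mul a)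
    let Q : (Fin K → ℝ) × (Fin n → Fin K → ℝ) → ℝ := fun p =>
      ⨆ t, ((A t + a * ∑ j, p.1 j * v 0 t j) + a * ∑ i, ∑ j, p.2 i j * v i.succ t j)
    have hQe : ∀ σ : Fin (n + 1) → Fin K → ℝ,
        Q (MeasurableEquiv.piFinSuccAbove (fun _ : Fin (n + 1) => Fin K → ℝ) 0 σ)
          = ⨆ t, (A t + a * ∑ i, ∑ j, σ i j * v i t j) := by
      intro σ
      refine iSup_congr fun t => ?_
      rw [Fin.sum_univ_succ, mul_add, ← add_assoc]
      rfl
    have hQ : Integrable Q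
        ((gaussianVector K).prod (Measure.pi fun _ : Fin n => gaussianVector K)) := by
      refine (hmp.integrable_comp_emb (MeasurableEquiv.measurableEmbedding _)).1 ?_
      exact (integrable_gaussianProcess A a v).congr (ae_of_all _ fun σ => (hQe σ).symm)
    calc signAvg n _ ≤ signAvg n fun ε => ∫ g, B ε g ∂(gaussianVector K) := by
          refine signAvg_mono fun ε => ?_
          refine le_trans (le_of_eq ?_) (avg_iSup_le_integral_iSup_gaussian
            (fun t => A t + ∑ i, boolSign (ε i) * ψ i.succ t) (ψ 0) (v 0) hL (hψ 0))
          simp only [Fin.sum_univ_succ, Fin.cons_zero, Fin.cons_succ, boolSign_true,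
            boolSign_false]
          congr 3 <;> ext t <;> ring
      _ = ∫ g, signAvg n (fun ε => B ε g) ∂(gaussianVector K) := (integral_signAvg hBi).symm
      _ ≤ ∫ g, ∫ σ, Q (g, σ) ∂(Measure.pi fun _ : Fin n => gaussianVector K)
            ∂(gaussianVector K) := by
          refine integral_mono (integrable_signAvg hBi) hQ.integral_prod_left fun g => ?_
          refine le_trans (le_of_eq ?_) (ih (fun t => A t + a * ∑ j, g j * v 0 t j)
            (fun i => ψ i.succ) (fun i => v i.succ) fun i => hψ i.succ)
          simp only [hB]
          congr 2 with ε
          congr 1 with t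
          ring
      _ = _ := by
          rw [← integral_prod _ hQ, ← hmp.integral_comp' Q]
          exact integral_congr_ae (ae_of_all _ hQe)

end Contraction

/-! ### Symmetrization: balanced against independent signs -/

/-- The supremum over a class of functions of the weighted sum of their values on a sample. -/
noncomputable def weightedSup {X T ι : Type*} [Fintype ι] (φ : T → X → ℝ) (w : ι → ℝ)
    (x : ι → X) : ℝ :=
  ⨆ t, ∑ i, w i * φ t (x i)

lemma weightedSup_piCongrLeft {X T ι κ : Type*} {φ : T → X → ℝ} [Fintype ι] [Fintype κ]
    (e : κ ≃ ι) (w : ι → ℝ) (x : κ → X) :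
    weightedSup φ w (Equiv.piCongrLeft (fun _ => X) e x) = weightedSup φ (w ∘ e) x := by
  refine iSup_congr fun t => ?_
  rw [← e.sum_comp]
  simp [Equiv.piCongrLeft_apply_apply]

/-- An i.i.d. sample is exchangeable, so only the multiset of weights matters. -/
lemma integral_weightedSup_comp_equiv {X T ι κ : Type*} [MeasurableSpace X] {μ : Measure X}
    [IsProbabilityMeasure μ] {φ : T → X → ℝ} [Fintype ι] [Fintype κ] (e : κ ≃ ι) (w : ι → ℝ) :
    ∫ x, weightedSup φ (w ∘ e) x ∂(Measure.pi fun _ => μ)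
      = ∫ x, weightedSup φ w x ∂(Measure.pi fun _ => μ) := by
  have hmp := measurePreserving_piCongrLeft (fun _ : ι => μ) e
  rw [← hmp.integral_comp']
  exact integral_congr_ae (ae_of_all _ fun x => (weightedSup_piCongrLeft e w x).symm)

/-- The weights `-1` on the first and `1` on the second half of a sample. -/
def halfSign (N : ℕ) : Fin N ⊕ Fin N → ℝ :=
  Sum.elim (fun _ => -1) fun _ => 1

lemma exists_equiv_halfSign {N : ℕ} {B : Finset (Fin (N + N))}
    (hB : B.card = N) : ∃ e : Fin N ⊕ Fin N ≃ Fin (N + N),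
      (fun i => boolSign (decide (i ∈ B))) ∘ e = halfSign N := by
  have h1 : Fintype.card {i // i ∈ B} = N := by simp [hB]
  have h2 : Fintype.card {i // i ∉ B} = N := by
    rw [Fintype.card_subtype_compl, h1, Fintype.card_fin, Nat.add_sub_cancel]
  -- The first half carries -1, hence the swap: it is the second half that must land in `B`.
  refine ⟨(Equiv.sumComm _ _).trans ((Equiv.sumCongr (Fintype.equivFinOfCardEq h1).symm
    (Fintype.equivFinOfCardEq h2).symm).trans (Equiv.sumCompl (· ∈ B))), ?_⟩
  ext (i | i)
  · have := ((Fintype.equivFinOfCardEq h2).symm i).2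
    simp [halfSign, this]
  · have := ((Fintype.equivFinOfCardEq h1).symm i).2
    simp [halfSign, this]

/-- A class of measurable functions with values in `[0, M]` whose weighted suprema over i.i.d.
samples are measurable up to null sets. -/
structure IsBoundedClass {X T : Type*} [MeasurableSpace X] (μ : Measure X) (φ : T → X → ℝ)
    (M : ℝ) : Prop where
  nonneg : ∀ t x, 0 ≤ φ t x
  le : ∀ t x, φ t x ≤ M
  measurable : ∀ t, Measurable (φ t)
  aemeasurable_fin : ∀ (n : ℕ) (w : Fin n → ℝ),
    AEMeasurable (weightedSup φ w) (Measure.pi fun _ => μ)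

namespace IsBoundedClass

variable {X T ι κ : Type*} [MeasurableSpace X] {μ : Measure X} {φ : T → X → ℝ}
  {M : ℝ} [Fintype ι] [Fintype κ]

lemma abs_sum_le (hφ : IsBoundedClass μ φ M) (w : ι → ℝ) (x : ι → X) (t : T) :
    |∑ i, w i * φ t (x i)| ≤ ∑ i, |w i| * M := by
  refine (Finset.abs_sum_le_sum_abs _ _).trans (Finset.sum_le_sum fun i _ => ?_)
  rw [abs_mul, abs_of_nonneg (hφ.nonneg _ _)]
  exact mul_le_mul_of_nonneg_left (hφ.le _ _) (abs_nonneg _)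

lemma bddAbove (hφ : IsBoundedClass μ φ M) (w : ι → ℝ) (x : ι → X) :
    BddAbove (Set.range fun t => ∑ i, w i * φ t (x i)) :=
  ⟨∑ i, |w i| * M, by rintro _ ⟨t, rfl⟩; exact (le_abs_self _).trans (hφ.abs_sum_le w x t)⟩

lemma sum_le_weightedSup (hφ : IsBoundedClass μ φ M) (w : ι → ℝ) (x : ι → X) (t : T) :
    ∑ i, w i * φ t (x i) ≤ weightedSup φ w x :=
  le_ciSup (hφ.bddAbove w x) t

lemma weightedSup_mono (hφ : IsBoundedClass μ φ M) {w w' : ι → ℝ} (h : w ≤ w') (x : ι → X) :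
    weightedSup φ w x ≤ weightedSup φ w' x :=
  ciSup_mono (hφ.bddAbove w' x) fun _ => Finset.sum_le_sum fun i _ =>
    mul_le_mul_of_nonneg_right (h i) (hφ.nonneg _ _)

lemma aemeasurable [IsProbabilityMeasure μ] (hφ : IsBoundedClass μ φ M) (w : ι → ℝ) :
    AEMeasurable (weightedSup φ w) (Measure.pi fun _ => μ) := by
  let e := (Fintype.equivFin ι).symm
  have hmp := measurePreserving_piCongrLeft (fun _ : ι => μ) e
  refine (hmp.aemeasurable_comp_iff (MeasurableEquiv.measurableEmbedding _)).1 ?_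
  refine (hφ.aemeasurable_fin _ (w ∘ e)).congr (ae_of_all _ fun x => ?_)
  exact (weightedSup_piCongrLeft e w x).symm

variable [Nonempty T]

lemma abs_weightedSup_le (hφ : IsBoundedClass μ φ M) (w : ι → ℝ) (x : ι → X) :
    |weightedSup φ w x| ≤ ∑ i, |w i| * M := by
  refine abs_le.2 ⟨?_, ciSup_le fun t => (le_abs_self _).trans (hφ.abs_sum_le w x t)⟩
  obtain ⟨t⟩ := ‹Nonempty T›
  exact (neg_le_of_abs_le (hφ.abs_sum_le w x t)).trans (hφ.sum_le_weightedSup w x t)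

/-- Because the functions are at most M, raising a weight costs at most M per unit. -/
lemma weightedSup_le_add (hφ : IsBoundedClass μ φ M) {w w' : ι → ℝ} (h : w ≤ w') (x : ι → X) :
    weightedSup φ w' x ≤ weightedSup φ w x + M * ∑ i, (w' i - w i) := by
  refine ciSup_le fun t => ?_
  have h1 : ∑ i, (w' i - w i) * φ t (x i) ≤ ∑ i, (w' i - w i) * M :=
    Finset.sum_le_sum fun i _ =>
      mul_le_mul_of_nonneg_left (hφ.le _ _) (sub_nonneg.2 (h i))
  simp_rw [sub_mul, Finset.sum_sub_distrib] at h1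
  rw [← Finset.sum_mul, ← Finset.sum_mul] at h1
  have h2 := hφ.sum_le_weightedSup w x t
  rw [Finset.sum_sub_distrib]
  linarith

variable [IsProbabilityMeasure μ]

lemma integrable (hφ : IsBoundedClass μ φ M) (w : ι → ℝ) :
    Integrable (weightedSup φ w) (Measure.pi fun _ => μ) :=
  Integrable.of_bound (hφ.aemeasurable w).aestronglyMeasurable (∑ i, |w i| * M)
    (ae_of_all _ fun x => hφ.abs_weightedSup_le w x)

/-- With too few plus signs in ε, enough of them are added to balance it, at a cost of M times the
deficit. With too many, some are turned into minus signs, and nonnegativity of the class makes this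
free. The quadratic in the error term replaces the deficit by something whose average is explicit.
-/
lemma integral_halfSign_le (hφ : IsBoundedClass μ φ M) (hM : 0 ≤ M) {N : ℕ} {b : ℝ} (hb : 0 < b)
    (ε : Fin (N + N) → Bool) :
    ∫ x, weightedSup φ (halfSign N) x ∂(Measure.pi fun _ => μ)
      ≤ ∫ x, weightedSup φ (fun i => boolSign (ε i)) x ∂(Measure.pi fun _ => μ)
        + M / (4 * b) * (∑ i, boolSign (ε i) - b) ^ 2 := by
  set S := ∑ i, boolSign (ε i) with hS
  -- Equivalent to (S + b)² ≥ 0.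
  have hsq : -S ≤ (S - b) ^ 2 / (4 * b) := by
    rw [le_div_iff₀ (by positivity)]
    nlinarith [sq_nonneg (S + b)]
  rw [div_mul_eq_mul_div, mul_div_assoc]
  rcases le_total (Finset.univ.filter fun i => ε i = true).card N with h | h
  · obtain ⟨B, hAB, -, hB⟩ := Finset.exists_subsuperset_card_eq
      (Finset.subset_univ (Finset.univ.filter fun i => ε i = true)) h (by simp)
    obtain ⟨e, he⟩ := exists_equiv_halfSign hB
    rw [← he, integral_weightedSup_comp_equiv]
    have hle : (fun i => boolSign (ε i)) ≤ fun i => boolSign (decide (i ∈ B)) := by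
      intro i
      cases hi : ε i
      · by_cases hiB : i ∈ B <;> simp [hi, hiB]
      · have : i ∈ B := hAB (by simp [hi])
        simp [hi, this]
    have hsum : ∑ i, boolSign (decide (i ∈ B)) = 0 := by
      rw [← e.sum_comp]
      exact (Fintype.sum_congr _ _ fun i => congrFun he i).trans (by simp [halfSign])
    calc ∫ x, weightedSup φ (fun i => boolSign (decide (i ∈ B))) x ∂(Measure.pi fun _ => μ)
        ≤ ∫ x, (weightedSup φ (fun i => boolSign (ε i)) x + M * -S)
            ∂(Measure.pi fun _ => μ) := by
          refine integral_mono (hφ.integrable _) ((hφ.integrable _).add (integrable_const _))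
            fun x => ?_
          refine (hφ.weightedSup_le_add hle x).trans (le_of_eq ?_)
          rw [Finset.sum_sub_distrib, hsum, zero_sub]
      _ = ∫ x, weightedSup φ (fun i => boolSign (ε i)) x ∂(Measure.pi fun _ => μ) + M * -S := by
          rw [integral_add (hφ.integrable _) (integrable_const _)]
          simp
      _ ≤ _ := by gcongr
  · obtain ⟨B, hBA, hB⟩ := Finset.exists_subset_card_eq h
    obtain ⟨e, he⟩ := exists_equiv_halfSign hB
    rw [← he, integral_weightedSup_comp_equiv]
    have hle : (fun i => boolSign (decide (i ∈ B))) ≤ fun i => boolSign (ε i) := by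
      intro i
      by_cases hiB : i ∈ B
      · have := hBA hiB
        simp only [Finset.mem_filter, Finset.mem_univ, true_and] at this
        simp [hiB, this]
      · cases hi : ε i <;> simp [hi, hiB]
    refine le_add_of_le_of_nonneg ?_ (by positivity)
    exact integral_mono (hφ.integrable _) (hφ.integrable _) fun x => hφ.weightedSup_mono hle x

/-- The balanced signs are, up to a lower order term, dominated by independent fair signs. -/
theorem integral_halfSign_le_signAvg (hφ : IsBoundedClass μ φ M) (hM : 0 ≤ M) {N : ℕ}
    (hN : 0 < N) :
    ∫ x, weightedSup φ (halfSign N) x ∂(Measure.pi fun _ => μ)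
      ≤ signAvg (N + N) (fun ε =>
          ∫ x, weightedSup φ (fun i => boolSign (ε i)) x ∂(Measure.pi fun _ => μ))
        + M * √((N + N : ℕ) : ℝ) / 2 := by
  -- The choice b = √(2N) minimizes the averaged error M(2N + b²)/(4b).
  have hb : 0 < √((N + N : ℕ) : ℝ) := Real.sqrt_pos.2 (by positivity)
  have h := signAvg_mono fun ε => hφ.integral_halfSign_le hM hb (N := N) ε
  rw [signAvg_const, signAvg_add, signAvg_const_mul, signAvg_sum_sub_sq,
    Real.sq_sqrt (by positivity)] at h
  refine h.trans (le_of_eq ?_)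
  congr 1
  have := Real.mul_self_sqrt (show (0 : ℝ) ≤ ((N + N : ℕ) : ℝ) by positivity)
  field_simp
  nlinarith

end IsBoundedClass

/-! ### Bounded differences and averaging over a second sample -/

section BoundedDifferences

variable {X : Type*} [MeasurableSpace X] {μ : Measure X} [IsProbabilityMeasure μ]

lemma integrable_exp_of_abs_le {Ω : Type*} [MeasurableSpace Ω] {P : Measure Ω} [IsFiniteMeasure P]
    {f : Ω → ℝ} (hf : AEStronglyMeasurable f P) {C : ℝ} (hC : ∀ x, |f x| ≤ C) (l a : ℝ) :
    Integrable (fun x => Real.exp (l * (f x - a))) P := by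
  refine Integrable.of_bound (C := Real.exp (|l| * (C + |a|))) ?_ (ae_of_all _ fun x => ?_)
  · exact Real.continuous_exp.comp_aestronglyMeasurable ((hf.sub aestronglyMeasurable_const).const_mul l)
  · rw [Real.norm_eq_abs, Real.abs_exp, Real.exp_le_exp]
    refine (le_abs_self _).trans ?_
    rw [abs_mul]
    gcongr
    exact (abs_sub _ _).trans (add_le_add_left (hC x) _)

/-- The partial mean of a function with bounded differences oscillates by at most `c`. -/
lemma exists_ae_mem_Icc_integral {Ω Ω' : Type*} [MeasurableSpace Ω] [MeasurableSpace Ω']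
    {P : Measure Ω} {Q : Measure Ω'} [IsProbabilityMeasure P] [IsProbabilityMeasure Q]
    {g : Ω × Ω' → ℝ} (hg : AEStronglyMeasurable g (P.prod Q)) {C : ℝ} (hC : ∀ p, |g p| ≤ C)
    {c : ℝ} (hc : ∀ x x' y, |g (x, y) - g (x', y)| ≤ c) :
    ∃ a, ∀ᵐ x ∂P, ∫ y, g (x, y) ∂Q ∈ Set.Icc a (a + c) := by
  have hgood := hg.prodMk_left
  -- Slices of an a.e. measurable function are measurable only for almost every `x`, and the Bochner
  -- integral is 0 by default elsewhere. The oscillation is therefore compared on `s` alone.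
  set s := {x | AEStronglyMeasurable (fun y => g (x, y)) Q} with hs
  have hint : ∀ x ∈ s, Integrable (fun y => g (x, y)) Q := fun x hx =>
    Integrable.of_bound hx C (ae_of_all _ fun y => hC _)
  have hosc : ∀ x ∈ s, ∀ x' ∈ s, ∫ y, g (x, y) ∂Q ≤ ∫ y, g (x', y) ∂Q + c := by
    intro x hx x' hx'
    have : ∫ y, g (x, y) ∂Q ≤ ∫ y, (g (x', y) + c) ∂Q :=
      integral_mono (hint x hx) ((hint x' hx').add (integrable_const _)) fun y => by
        have := (abs_le.1 (hc x x' y)).2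
        linarith
    rwa [integral_add (hint x' hx') (integrable_const _), integral_const, probReal_univ,
      one_smul] at this
  obtain ⟨x₀, hx₀⟩ : s.Nonempty := hgood.exists
  have hbdd : BddBelow ((fun x => ∫ y, g (x, y) ∂Q) '' s) := by
    refine ⟨∫ y, g (x₀, y) ∂Q - c, ?_⟩
    rintro _ ⟨x, hx, rfl⟩
    have := hosc x₀ hx₀ x hx
    simp only [tsub_le_iff_right]
    exact this
  refine ⟨sInf ((fun x => ∫ y, g (x, y) ∂Q) '' s), ?_⟩
  filter_upwards [hgood] with x hx
  refine ⟨csInf_le hbdd ⟨x, hx, rfl⟩, ?_⟩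
  rw [← sub_le_iff_le_add]
  refine le_csInf ⟨_, x₀, hx₀, rfl⟩ ?_
  rintro _ ⟨x', hx', rfl⟩
  have := hosc x hx x' hx'
  simp only [tsub_le_iff_right]
  exact this

/-- The bounded differences inequality, in terms of moment generating functions. -/
theorem integral_exp_le_of_bounded_differences_fin {n : ℕ} {f : (Fin n → X) → ℝ}
    (hf : AEStronglyMeasurable f (Measure.pi fun _ => μ)) {C : ℝ} (hC : ∀ x, |f x| ≤ C) {c : ℝ}
    (hc : ∀ x i a, |f (Function.update x i a) - f x| ≤ c) (l : ℝ) :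
    ∫ x, Real.exp (l * (f x - ∫ y, f y ∂(Measure.pi fun _ => μ))) ∂(Measure.pi fun _ => μ)
      ≤ Real.exp (n * (l ^ 2 * c ^ 2 / 8)) := by
  induction n with
  | zero =>
    have : f = fun _ => f default := funext fun x => congrArg f (Subsingleton.elim _ _)
    rw [this]
    simp
  | succ n ih =>
    have hmp := measurePreserving_piFinSuccAbove (fun _ : Fin (n + 1) => μ) 0
    have hemb := (MeasurableEquiv.piFinSuccAbove (fun _ : Fin (n + 1) => X) 0).measurableEmbedding
    set ν := Measure.pi fun _ : Fin n => μ with hν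
    set g : X × (Fin n → X) → ℝ := fun p => f (Fin.cons p.1 p.2) with hg
    have hfg : ∀ x, g (MeasurableEquiv.piFinSuccAbove (fun _ : Fin (n + 1) => X) 0 x) = f x :=
      fun x => congrArg f (Fin.cons_self_tail x)
    have hgm : AEStronglyMeasurable g (μ.prod ν) := by
      refine (hmp.aestronglyMeasurable_comp_iff hemb).1 ?_
      exact hf.congr (ae_of_all _ fun x => (hfg x).symm)
    have hgC : ∀ p, |g p| ≤ C := fun p => hC _
    have hgi : Integrable g (μ.prod ν) := Integrable.of_bound hgm C (ae_of_all _ hgC)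
    set m : X → ℝ := fun a => ∫ x, g (a, x) ∂ν with hm
    have hEf : ∫ x, f x ∂(Measure.pi fun _ => μ) = ∫ a, m a ∂μ := by
      rw [hm, ← integral_prod _ hgi, ← hmp.integral_comp' g]
      exact integral_congr_ae (ae_of_all _ fun x => (hfg x).symm)
    have hc0 : ∀ a a' x, |g (a, x) - g (a', x)| ≤ c := fun a a' x => by
      have := hc (Fin.cons a' x) 0 a
      rwa [Fin.update_cons_zero] at this
    have hc' : 0 ≤ c := by
      obtain ⟨a⟩ := nonempty_of_isProbabilityMeasure μ
      exact (abs_nonneg _).trans (hc0 a a fun _ => a)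
    obtain ⟨b, hb⟩ := exists_ae_mem_Icc_integral hgm hgC hc0
    have hmm : AEMeasurable m μ := hgi.integral_prod_left.aemeasurable
    -- Hoeffding's lemma for the conditional mean given the first coordinate, which lies in an
    -- interval of length `c`. The induction hypothesis handles the other coordinates on each slice.
    have hhoeff := (hasSubgaussianMGF_of_mem_Icc hmm hb).mgf_le l
    set E := ∫ a, m a ∂μ with hE
    have hint : Integrable (fun p => Real.exp (l * (g p - E))) (μ.prod ν) :=
      integrable_exp_of_abs_le hgm hgC l E
    have hmi := (hasSubgaussianMGF_of_mem_Icc hmm hb).integrable_exp_mul l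
    calc ∫ x, Real.exp (l * (f x - ∫ y, f y ∂(Measure.pi fun _ => μ)))
          ∂(Measure.pi fun _ => μ)
        = ∫ a, ∫ x, Real.exp (l * (g (a, x) - E)) ∂ν ∂μ := by
          rw [hEf, ← integral_prod _ hint, ← hmp.integral_comp']
          exact integral_congr_ae (ae_of_all _ fun x => by simp only [hfg])
      _ ≤ ∫ a, Real.exp (l * (m a - E)) * Real.exp (n * (l ^ 2 * c ^ 2 / 8)) ∂μ := by
          refine integral_mono_ae hint.integral_prod_left (hmi.mul_const _) ?_
          filter_upwards [hgm.prodMk_left] with a ha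
          have := ih (f := fun x => g (a, x)) ha (fun x => hgC _) fun x i y => by
            have := hc (Fin.cons a x) i.succ y
            rwa [← Fin.cons_update] at this
          refine le_trans (le_of_eq ?_)
            (mul_le_mul_of_nonneg_left this (Real.exp_pos (l * (m a - E))).le)
          rw [← integral_const_mul]
          refine integral_congr_ae (ae_of_all _ fun x => ?_)
          simp only [← Real.exp_add]
          congr 1
          simp only [hm]
          ring
      _ = Real.exp (n * (l ^ 2 * c ^ 2 / 8)) * mgf (fun a => m a - E) μ l := by
          rw [integral_mul_const, mul_comm]
          rfl
      _ ≤ Real.exp (n * (l ^ 2 * c ^ 2 / 8)) * Real.exp (l ^ 2 * c ^ 2 / 8) := by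
          refine mul_le_mul_of_nonneg_left (hhoeff.trans (le_of_eq ?_)) (Real.exp_pos _).le
          congr 1
          push_cast
          rw [add_sub_cancel_left, Real.norm_of_nonneg hc']
          ring
      _ = Real.exp ((n + 1 : ℕ) * (l ^ 2 * c ^ 2 / 8)) := by
          rw [← Real.exp_add]
          push_cast
          ring_nf

theorem integral_exp_le_of_bounded_differences {ι : Type*} [Fintype ι] [DecidableEq ι]
    {f : (ι → X) → ℝ} (hf : AEStronglyMeasurable f (Measure.pi fun _ => μ)) {C : ℝ}
    (hC : ∀ x, |f x| ≤ C) {c : ℝ} (hc : ∀ x i a, |f (Function.update x i a) - f x| ≤ c) (l : ℝ) :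
    ∫ x, Real.exp (l * (f x - ∫ y, f y ∂(Measure.pi fun _ => μ))) ∂(Measure.pi fun _ => μ)
      ≤ Real.exp ((Fintype.card ι : ℝ) * (l ^ 2 * c ^ 2 / 8)) := by
  let e := (Fintype.equivFin ι).symm
  have hmp := measurePreserving_piCongrLeft (fun _ : ι => μ) e
  have h := integral_exp_le_of_bounded_differences_fin (μ := μ)
    (f := fun x => f (MeasurableEquiv.piCongrLeft (fun _ => X) e x))
    (hf.comp_measurePreserving hmp) (fun x => hC _) (c := c) (fun x i a => ?_) l
  · rw [hmp.integral_comp'] at h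
    rwa [← hmp.integral_comp']
  · have : MeasurableEquiv.piCongrLeft (fun _ => X) e (Function.update x i a)
        = Function.update (MeasurableEquiv.piCongrLeft (fun _ => X) e x) (e i) a := by
      ext j
      obtain ⟨k, rfl⟩ := e.surjective j
      rw [MeasurableEquiv.coe_piCongrLeft, Equiv.piCongrLeft_apply_apply]
      rcases eq_or_ne k i with rfl | h
      · simp
      · rw [Function.update_of_ne h, Function.update_of_ne (e.injective.ne h),
          Equiv.piCongrLeft_apply_apply]
    rw [this]
    exact hc _ _ _

/-- If a function of a sample and of an independent second sample has bounded differences, then its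
mean over the second sample exceeds its mean only by little, with high probability. -/
theorem exists_measurableSet_integral_le_of_bounded_differences {κ κ' : Type*} [Fintype κ]
    [Fintype κ'] [DecidableEq κ] [DecidableEq κ'] [Nonempty κ] {f : (κ ⊕ κ' → X) → ℝ}
    (hf : AEStronglyMeasurable f (Measure.pi fun _ => μ)) {C : ℝ}
    (hC : ∀ x, |f x| ≤ C) {c : ℝ} (hc₀ : 0 < c)
    (hc : ∀ x i a, |f (Function.update x i a) - f x| ≤ c) {δ : ℝ} (hδ₀ : 0 < δ) (hδ₁ : δ < 1) :
    ∃ A : Set (κ → X), MeasurableSet A ∧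
      ENNReal.ofReal (1 - δ) ≤ (Measure.pi fun _ => μ) A ∧
      ∀ x ∈ A, Integrable (fun y => f (Sum.elim x y)) (Measure.pi fun _ => μ) ∧
        ∫ y, f (Sum.elim x y) ∂(Measure.pi fun _ => μ) ≤ ∫ z, f z ∂(Measure.pi fun _ => μ)
          + c * √((Fintype.card (κ ⊕ κ') : ℝ) * Real.log (1 / δ) / 2) := by
  set ν := Measure.pi fun _ : κ => μ with hν
  set ν' := Measure.pi fun _ : κ' => μ with hν'
  set k : ℝ := (Fintype.card (κ ⊕ κ') : ℝ) with hk
  have hk0 : 0 < k := by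
    rw [hk]
    exact_mod_cast Fintype.card_pos
  have hlog : 0 < Real.log (1 / δ) := Real.log_pos ((one_lt_div hδ₀).2 hδ₁)
  set τ := c * √(k * Real.log (1 / δ) / 2) with hτ
  have hτ0 : 0 < τ := by positivity
  set E := ∫ z, f z ∂(Measure.pi fun _ : κ ⊕ κ' => μ) with hE
  have hmp := (measurePreserving_sumPiEquivProdPi_symm (X := fun _ : κ ⊕ κ' => X) fun _ => μ)
  set g : (κ → X) × (κ' → X) → ℝ := fun p => f (Sum.elim p.1 p.2) with hg
  have hfg : ∀ p, f ((MeasurableEquiv.sumPiEquivProdPi fun _ : κ ⊕ κ' => X).symm p) = g p := by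
    intro p
    refine congrArg f (funext fun i => ?_)
    cases i <;> rfl
  have hgm : AEStronglyMeasurable g (ν.prod ν') :=
    (hf.comp_measurePreserving hmp).congr (ae_of_all _ hfg)
  have hgC : ∀ p, |g p| ≤ C := fun p => hC _
  have hgi : Integrable g (ν.prod ν') := Integrable.of_bound hgm C (ae_of_all _ hgC)
  -- Minimizer of the Chernoff exponent -lτ + k l² c²/8. The value there is -2τ²/(k c²), which
  -- equals log δ by the choice of τ.
  set l := 4 * τ / (k * c ^ 2) with hl
  have hl0 : 0 ≤ l := by positivity
  have hint : Integrable (fun p => Real.exp (l * (g p - E))) (ν.prod ν') :=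
    integrable_exp_of_abs_le hgm hgC l E
  set Y : (κ → X) → ℝ := fun x => ∫ y, g (x, y) ∂ν' - E with hY
  have hmgf : ∫ p, Real.exp (l * (g p - E)) ∂(ν.prod ν') ≤ Real.exp (k * (l ^ 2 * c ^ 2 / 8)) := by
    refine le_trans (le_of_eq ?_) (integral_exp_le_of_bounded_differences hf hC hc l)
    rw [← hmp.integral_comp']
    exact integral_congr_ae (ae_of_all _ fun p => by simp only [hfg]; rfl)
  have hYm : AEStronglyMeasurable (fun x => ∫ y, g (x, y) ∂ν') ν :=
    hgi.integral_prod_left.aestronglyMeasurable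
  have hYint : Integrable (fun x => Real.exp (l * Y x)) ν := by
    refine integrable_exp_of_abs_le hYm (C := C) (fun x => ?_) l E
    refine (norm_integral_le_of_norm_le_const (μ := ν') (f := fun y => g (x, y)) (C := C)
      (ae_of_all _ fun y => hgC _)).trans ?_
    simp
  -- Averaging over the second sample can only lower the moment generating function, by convexity of
  -- exp.
  have hjensen : mgf Y ν l ≤ ∫ p, Real.exp (l * (g p - E)) ∂(ν.prod ν') := by
    rw [integral_prod _ hint]
    refine integral_mono_ae hYint hint.integral_prod_left ?_
    filter_upwards [hgm.prodMk_left] with x hx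
    have hgx : Integrable (fun y => g (x, y)) ν' :=
      Integrable.of_bound hx C (ae_of_all _ fun y => hgC _)
    have hconv := ConvexOn.map_integral_le (μ := ν') (f := fun y => l * (g (x, y) - E))
      convexOn_exp Real.continuous_exp.continuousOn isClosed_univ (by simp)
      ((hgx.sub (integrable_const _)).const_mul l) (integrable_exp_of_abs_le hx (fun y => hgC _) l E)
    refine le_trans (le_of_eq ?_) hconv
    rw [integral_const_mul, integral_sub hgx (integrable_const _)]
    simp [hY]
  have hbad : ν.real {x | τ ≤ Y x} ≤ δ := by
    refine (measure_ge_le_exp_mul_mgf τ hl0 hYint).trans ?_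
    refine (mul_le_mul_of_nonneg_left (hjensen.trans hmgf) (Real.exp_pos _).le).trans ?_
    rw [← Real.exp_add, ← Real.le_log_iff_exp_le hδ₀]
    have hτsq : τ ^ 2 = c ^ 2 * (k * Real.log (1 / δ) / 2) := by
      rw [hτ, mul_pow, Real.sq_sqrt (by positivity)]
    have : -l * τ + k * (l ^ 2 * c ^ 2 / 8) = -2 * τ ^ 2 / (k * c ^ 2) := by
      rw [hl]
      field_simp
      ring
    rw [this, hτsq, one_div, Real.log_inv]
    refine le_of_eq ?_
    field_simp
  set B := {x | τ ≤ Y x} ∪ {x | ¬ AEStronglyMeasurable (fun y => g (x, y)) ν'} with hB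
  have hBδ : ν B ≤ ENNReal.ofReal δ := by
    refine (measure_union_le _ _).trans ?_
    have h0 : ν {x | ¬ AEStronglyMeasurable (fun y => g (x, y)) ν'} = 0 := hgm.prodMk_left
    rw [h0, add_zero, ← ENNReal.ofReal_toReal (measure_ne_top ν _)]
    exact ENNReal.ofReal_le_ofReal hbad
  refine ⟨(toMeasurable ν B)ᶜ, (measurableSet_toMeasurable _ _).compl, ?_, fun x hx => ?_⟩
  · rw [prob_compl_eq_one_sub (measurableSet_toMeasurable _ _), measure_toMeasurable,
      ENNReal.ofReal_sub _ hδ₀.le, ENNReal.ofReal_one]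
    exact tsub_le_tsub_left hBδ _
  · have hxB : x ∉ B := fun h => hx (subset_toMeasurable _ _ h)
    simp only [hB, Set.mem_union, Set.mem_ofPred_eq, not_or, not_not, not_le] at hxB
    refine ⟨Integrable.of_bound hxB.2 C (ae_of_all _ fun y => hgC (x, y)), ?_⟩
    have := hxB.1
    simp only [hY] at this
    linarith

end BoundedDifferences

/-! ### Uniform excess risk through a ghost sample -/

/-- The largest deviation between two halves of a sample, relative to a reference function. -/
noncomputable def excessDeviation {X T : Type*} (φ : T → X → ℝ) (t₀ : T) (N : ℕ)
    (z : Fin N ⊕ Fin N → X) : ℝ :=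
  (weightedSup φ (halfSign N) z - ∑ i, halfSign N i * φ t₀ (z i)) / N

namespace IsBoundedClass

variable {X T : Type*} [MeasurableSpace X] {μ : Measure X} {φ : T → X → ℝ} {M : ℝ}

lemma integrable_apply [IsFiniteMeasure μ] (hφ : IsBoundedClass μ φ M) (t : T) :
    Integrable (φ t) μ :=
  Integrable.of_bound (hφ.measurable t).aestronglyMeasurable M (ae_of_all _ fun x => by
    rw [Real.norm_of_nonneg (hφ.nonneg t x)]
    exact hφ.le t x)

section

variable [Nonempty T] {N : ℕ}

/-- One coordinate moves the term of any member by at most M, and likewise that of the reference.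
Hence 2M. -/
lemma excessDeviation_update_le (hφ : IsBoundedClass μ φ M) (t₀ : T) (z : Fin N ⊕ Fin N → X)
    (i : Fin N ⊕ Fin N) (a : X) :
    excessDeviation φ t₀ N (Function.update z i a) ≤ excessDeviation φ t₀ N z + 2 * M / N := by
  rw [excessDeviation, excessDeviation, ← add_div]
  refine div_le_div_of_nonneg_right ?_ N.cast_nonneg
  have hupd : ∀ t, ∑ j, halfSign N j * φ t (Function.update z i a j)
      = ∑ j, halfSign N j * φ t (z j) + halfSign N i * (φ t a - φ t (z i)) := by
    intro t
    rw [← sub_eq_iff_eq_add', ← Finset.sum_sub_distrib, Finset.sum_eq_single i]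
    · rw [Function.update_self]
      ring
    · intro j _ hj
      rw [Function.update_of_ne hj, sub_self]
    · simp
  have hsup : weightedSup φ (halfSign N) (Function.update z i a)
      ≤ weightedSup φ (halfSign N) z + halfSign N i * (φ t₀ a - φ t₀ (z i)) + 2 * M := by
    refine ciSup_le fun t => ?_
    rw [hupd]
    have h1 := hφ.sum_le_weightedSup (halfSign N) z t
    have h2 := hφ.nonneg t a
    have h3 := hφ.le t a
    have h4 := hφ.nonneg t (z i)
    have h5 := hφ.le t (z i)
    have h6 := hφ.nonneg t₀ a
    have h7 := hφ.le t₀ a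
    have h8 := hφ.nonneg t₀ (z i)
    have h9 := hφ.le t₀ (z i)
    rcases i with i | i <;> simp only [halfSign, Sum.elim_inl, Sum.elim_inr] at h1 ⊢ <;> linarith
  rw [hupd]
  linarith

lemma abs_excessDeviation_update_sub_le (hφ : IsBoundedClass μ φ M) (t₀ : T)
    (z : Fin N ⊕ Fin N → X) (i : Fin N ⊕ Fin N) (a : X) :
    |excessDeviation φ t₀ N (Function.update z i a) - excessDeviation φ t₀ N z| ≤ 2 * M / N := by
  have h1 := hφ.excessDeviation_update_le t₀ z i a
  have h2 := hφ.excessDeviation_update_le t₀ (Function.update z i a) i (z i)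
  rw [Function.update_idem, Function.update_eq_self] at h2
  exact abs_le.2 ⟨by linarith, by linarith⟩

end

variable [IsProbabilityMeasure μ]

lemma integrable_apply_eval {ι : Type*} [Fintype ι] (hφ : IsBoundedClass μ φ M) (t : T) (i : ι) :
    Integrable (fun x : ι → X => φ t (x i)) (Measure.pi fun _ => μ) :=
  integrable_comp_eval (μ := fun _ : ι => μ) (hφ.integrable_apply t)

lemma integral_sum_eval {ι : Type*} [Fintype ι] (hφ : IsBoundedClass μ φ M) (w : ι → ℝ) (t : T) :
    ∫ x, ∑ i, w i * φ t (x i) ∂(Measure.pi fun _ : ι => μ) = (∑ i, w i) * ∫ a, φ t a ∂μ := by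
  rw [integral_finsetSum _ fun i _ => (hφ.integrable_apply_eval t i).const_mul _, Finset.sum_mul]
  refine Finset.sum_congr rfl fun i _ => ?_
  rw [integral_const_mul, integral_comp_eval (μ := fun _ : ι => μ) (f := φ t)
    (hφ.measurable t).aestronglyMeasurable]

variable [Nonempty T] {N : ℕ}

/-- With high probability, the excess risk of every member of the class over a reference member is
close to its empirical counterpart. -/
theorem exists_measurableSet_excess_le (hφ : IsBoundedClass μ φ M) (hM : 0 < M) (hN : 0 < N)
    (t₀ : T) {ρ : ℝ}
    (hρ : signAvg (N + N) (fun ε =>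
      ∫ x, weightedSup φ (fun i => boolSign (ε i)) x ∂(Measure.pi fun _ => μ)) ≤ ρ)
    {δ : ℝ} (hδ₀ : 0 < δ) (hδ₁ : δ < 1) :
    ∃ A : Set (Fin N → X), MeasurableSet A ∧
      ENNReal.ofReal (1 - δ) ≤ (Measure.pi fun _ => μ) A ∧
      ∀ x ∈ A, ∀ t, ∫ a, φ t a ∂μ - ∫ a, φ t₀ a ∂μ
        ≤ (∑ i, φ t (x i) - ∑ i, φ t₀ (x i)) / N + (ρ + M * √((N + N : ℕ) : ℝ) / 2) / N
          + 2 * M / N * √(((N + N : ℕ) : ℝ) * Real.log (1 / δ) / 2) := by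
  have hN' : (0 : ℝ) < N := by exact_mod_cast hN
  have : Nonempty (Fin N) := ⟨⟨0, hN⟩⟩
  have hint₀ : Integrable (fun z : Fin N ⊕ Fin N → X => ∑ i, halfSign N i * φ t₀ (z i))
      (Measure.pi fun _ => μ) :=
    integrable_finsetSum _ fun i _ => (hφ.integrable_apply_eval t₀ i).const_mul _
  have hint : Integrable (excessDeviation φ t₀ N) (Measure.pi fun _ => μ) :=
    ((hφ.integrable _).sub hint₀).div_const _
  have hbound : ∀ z, |excessDeviation φ t₀ N z|
      ≤ (∑ i, |halfSign N i| * M + ∑ i, |halfSign N i| * M) / N := by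
    intro z
    rw [excessDeviation, abs_div, Nat.abs_cast]
    gcongr
    exact (abs_sub _ _).trans (add_le_add (hφ.abs_weightedSup_le _ _) (hφ.abs_sum_le _ _ _))
  have hmean : ∫ z, excessDeviation φ t₀ N z ∂(Measure.pi fun _ => μ)
      ≤ (ρ + M * √((N + N : ℕ) : ℝ) / 2) / N := by
    -- The weights sum to zero, so the reference function leaves the mean unchanged.
    have h0 : ∫ z, ∑ i, halfSign N i * φ t₀ (z i) ∂(Measure.pi fun _ => μ) = 0 := by
      rw [hφ.integral_sum_eval]
      simp [halfSign]
    unfold excessDeviation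
    rw [integral_div, integral_sub (hφ.integrable _) hint₀, h0, sub_zero]
    gcongr
    exact (hφ.integral_halfSign_le_signAvg hM.le hN).trans (by gcongr)
  obtain ⟨A, hA, hAδ, hAle⟩ := exists_measurableSet_integral_le_of_bounded_differences
    hint.aestronglyMeasurable hbound (show 0 < 2 * M / N by positivity)
    (hφ.abs_excessDeviation_update_sub_le t₀) hδ₀ hδ₁
  refine ⟨A, hA, hAδ, fun x hx t => ?_⟩
  obtain ⟨hi, hle⟩ := hAle x hx
  have hsum : ∀ t, Integrable (fun y : Fin N → X => ∑ i, φ t (y i)) (Measure.pi fun _ => μ) :=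
    fun t => integrable_finsetSum _ fun i _ => hφ.integrable_apply_eval t i
  have hsumint : ∀ t, ∫ y, ∑ i, φ t (y i) ∂(Measure.pi fun _ : Fin N => μ)
      = N * ∫ a, φ t a ∂μ := fun t => by
    simpa using hφ.integral_sum_eval (fun _ : Fin N => (1 : ℝ)) t
  -- Any fixed member bounds the supremum from below, and averaging over the ghost sample `y` turns
  -- its empirical risk into its true risk.
  have hlow : ∫ y, ((∑ i, φ t (y i) - ∑ i, φ t₀ (y i)) - (∑ i, φ t (x i) - ∑ i, φ t₀ (x i))) / N
        ∂(Measure.pi fun _ : Fin N => μ)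
      ≤ ∫ y, excessDeviation φ t₀ N (Sum.elim x y) ∂(Measure.pi fun _ => μ) := by
    refine integral_mono ((((hsum t).sub (hsum t₀)).sub (integrable_const _)).div_const _) hi
      fun y => ?_
    refine div_le_div_of_nonneg_right ?_ N.cast_nonneg
    have := hφ.sum_le_weightedSup (halfSign N) (Sum.elim x y) t
    simp only [Fintype.sum_sum_type, halfSign, Sum.elim_inl, Sum.elim_inr, neg_one_mul,
      one_mul, Finset.sum_neg_distrib] at this ⊢
    linarith
  have hsub : Integrable (fun y : Fin N → X => ∑ i, φ t (y i) - ∑ i, φ t₀ (y i))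
      (Measure.pi fun _ => μ) := (hsum t).sub (hsum t₀)
  rw [integral_div, integral_sub hsub (integrable_const _),
    integral_sub (hsum t) (hsum t₀), hsumint, hsumint] at hlow
  simp only [integral_const, probReal_univ, one_smul] at hlow
  have hcard : (Fintype.card (Fin N ⊕ Fin N) : ℝ) = ((N + N : ℕ) : ℝ) := by simp
  rw [hcard] at hle
  have hsplit : ∫ a, φ t a ∂μ - ∫ a, φ t₀ a ∂μ
      = (∑ i, φ t (x i) - ∑ i, φ t₀ (x i)) / N
        + (N * ∫ a, φ t a ∂μ - N * ∫ a, φ t₀ a ∂μ - (∑ i, φ t (x i) - ∑ i, φ t₀ (x i))) / N := by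
    field_simp
    ring
  linarith

end IsBoundedClass

/-! ### Extended-valued expectations and the cross-entropy loss -/

/-- `X` need not be measurable: the lower integral is monotone for arbitrary functions, which suits
uncountable Gaussian suprema. -/
lemma integral_le_expectation {Ω : Type*} [MeasurableSpace Ω] {μ : Measure Ω} {Y : Ω → ℝ}
    {X : Ω → EReal} (hY : Integrable Y μ) (h : ∀ ω, (Y ω : EReal) ≤ X ω) :
    ((∫ ω, Y ω ∂μ : ℝ) : EReal) ≤ expectation μ X := by
  have hpos : ∫⁻ ω, ENNReal.ofReal (Y ω) ∂μ ≠ ∞ := hY.lintegral_lt_top.ne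
  have hneg : ∫⁻ ω, ENNReal.ofReal (-Y ω) ∂μ ≠ ∞ := hY.neg.lintegral_lt_top.ne
  rw [integral_eq_lintegral_pos_part_sub_lintegral_neg_part hY, EReal.coe_sub,
    EReal.coe_ennreal_toReal hpos, EReal.coe_ennreal_toReal hneg]
  refine EReal.sub_le_sub (EReal.coe_ennreal_le_coe_ennreal_iff.2 (lintegral_mono fun ω => ?_))
    (EReal.coe_ennreal_le_coe_ennreal_iff.2 (lintegral_mono fun ω => ?_))
  · exact EReal.toENNReal_le_toENNReal (h ω)
  · exact EReal.toENNReal_le_toENNReal (EReal.neg_le_neg_iff.2 (h ω))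

lemma expectation_of_nonneg {Ω : Type*} [MeasurableSpace Ω] {μ : Measure Ω} {X : Ω → EReal}
    (h : ∀ ω, 0 ≤ X ω) : expectation μ X = ((∫⁻ ω, (X ω).toENNReal ∂μ : ℝ≥0∞) : EReal) := by
  have : ∀ ω, (-X ω).toENNReal = 0 := fun ω =>
    EReal.toENNReal_of_nonpos (EReal.neg_le_zero.2 (h ω))
  simp [expectation, this]

lemma crossEntropy_nonneg {K : ℕ} (v : EuclideanSpace ℝ (Fin K)) (y : Fin K) :
    0 ≤ crossEntropy v y := by
  refine neg_nonneg.2 (Real.log_nonpos (by positivity) (div_le_one_of_le₀ ?_ (by positivity)))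
  exact Finset.single_le_sum (f := fun i => Real.exp (v i)) (fun i _ => (Real.exp_pos _).le)
    (Finset.mem_univ y)

lemma measurable_crossEntropy {K : ℕ} :
    Measurable fun p : EuclideanSpace ℝ (Fin K) × Fin K => crossEntropy p.1 p.2 := by
  refine measurable_from_prod_countable_left fun y => ?_
  dsimp only [crossEntropy]
  fun_prop

/-! ### From losses of models to Gaussian complexity -/

section Model

variable {d₁ d₂ K : ℕ} {F : Set (EuclideanSpace ℝ (Fin d₂) → EuclideanSpace ℝ (Fin K))}
  {H : Set (EuclideanSpace ℝ (Fin d₁) → EuclideanSpace ℝ (Fin d₂))}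
  {PX : Measure (EuclideanSpace ℝ (Fin d₁))} {c : EuclideanSpace ℝ (Fin d₁) → Fin K}

variable (F H c) in
/-- The loss at an input, labelled by the clustering rule, of the model given by a classifier and a
feature extractor. -/
noncomputable def modelLoss (p : F × H) (x : EuclideanSpace ℝ (Fin d₁)) : ℝ :=
  crossEntropy (p.1.1 (p.2.1 x)) (c x)

lemma IsMeasurableClass.isBoundedClass (h : IsMeasurableClass F H PX c) {M : ℝ}
    (hM : ∀ i : Fin K, ∀ f ∈ F, ∀ h ∈ H, ∀ x, crossEntropy (f (h x)) i ≤ M) :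
    IsBoundedClass PX (modelLoss F H c) M where
  nonneg _ _ := crossEntropy_nonneg _ _
  le p _ := hM _ _ p.1.2 _ p.2.2 _
  measurable p := measurable_crossEntropy.comp
    (((h.measurable_classifier _ p.1.2).comp (h.measurable_extractor _ p.2.2)).prodMk
      h.measurable_clustering)
  aemeasurable_fin := h.aemeasurable_sup

variable [Nonempty F] [Nonempty H]

variable (F H) in
/-- The Gaussian complexity of a class of models on a fixed sample. -/
noncomputable def sampleComplexity {n : ℕ} (x : Fin n → EuclideanSpace ℝ (Fin d₁)) : EReal :=
  expectation (Measure.pi fun _ : Fin n => gaussianVector K) fun σ =>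
    ⨆ p : F × H, ((∑ i, ∑ j, σ i j * p.1.1 (p.2.1 (x i)) j : ℝ) : EReal)

lemma integrable_gaussianSum {n : ℕ} (v : Fin n → EuclideanSpace ℝ (Fin K)) :
    Integrable (fun σ : Fin n → Fin K → ℝ => ∑ i, ∑ j, σ i j * v i j)
      (Measure.pi fun _ => gaussianVector K) :=
  integrable_finsetSum _ fun i _ => integrable_comp_eval (μ := fun _ : Fin n => gaussianVector K)
    (f := fun g : Fin K → ℝ => ∑ j, g j * v i j) (integrable_linear_gaussianVector (v i))

/-- A single model already contributes a centred Gaussian sum. The outer expectation of the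
complexity thus reduces to a lower integral. -/
lemma sampleComplexity_nonneg {n : ℕ} (x : Fin n → EuclideanSpace ℝ (Fin d₁)) :
    0 ≤ sampleComplexity F H x := by
  obtain ⟨p⟩ := (inferInstance : Nonempty (F × H))
  have h := integral_le_expectation (integrable_gaussianSum fun i => p.1.1 (p.2.1 (x i)))
    fun σ => le_iSup (fun p : F × H =>
      ((∑ i, ∑ j, σ i j * p.1.1 (p.2.1 (x i)) j : ℝ) : EReal)) p
  refine le_trans (le_of_eq ?_) h
  rw [integral_finsetSum _ fun i _ =>
    integrable_comp_eval (μ := fun _ : Fin n => gaussianVector K)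
      (f := fun g : Fin K → ℝ => ∑ j, g j * p.1.1 (p.2.1 (x i)) j)
      (integrable_linear_gaussianVector _)]
  have h0 : ∀ i, ∫ σ, ∑ j, σ i j * p.1.1 (p.2.1 (x i)) j
      ∂(Measure.pi fun _ : Fin n => gaussianVector K) = 0 := by
    intro i
    rw [integral_comp_eval (μ := fun _ : Fin n => gaussianVector K)
      (f := fun g : Fin K → ℝ => ∑ j, g j * p.1.1 (p.2.1 (x i)) j)
      (integrable_linear_gaussianVector _).aestronglyMeasurable]
    exact integral_linear_gaussianVector _
  simp [h0]

lemma gaussianComplexity_eq_lintegral (n : ℕ) :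
    gaussianComplexity n F H PX
      = ((∫⁻ x : Fin n → EuclideanSpace ℝ (Fin d₁), (sampleComplexity F H x).toENNReal
          ∂(Measure.pi fun _ => PX) : ℝ≥0∞) : EReal) :=
  expectation_of_nonneg fun x => sampleComplexity_nonneg x

/-- There are only 2^n sign patterns, so one near-maximizer for each yields a finite subfamily with
almost the same sign average. Contraction applies to that subfamily, whose Gaussian supremum is
integrable and lies below the full one. -/
lemma signAvg_weightedSup_le_sampleComplexity {L : ℝ≥0}
    (hL : ∀ y : Fin K, LipschitzWith L fun v : EuclideanSpace ℝ (Fin K) => crossEntropy v y)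
    {n : ℕ} (x : Fin n → EuclideanSpace ℝ (Fin d₁)) :
    ENNReal.ofReal (signAvg n fun ε => weightedSup (modelLoss F H c) (fun i => boolSign (ε i)) x)
      ≤ ENNReal.ofReal (L * √(Real.pi / 2)) * (sampleComplexity F H x).toENNReal := by
  refine ENNReal.le_of_forall_pos_le_add fun η hη _ => ?_
  have hη' : (0 : ℝ) < η := hη
  have hex : ∀ ε : Fin n → Bool, ∃ p : F × H,
      weightedSup (modelLoss F H c) (fun i => boolSign (ε i)) x - η
        < ∑ i, boolSign (ε i) * modelLoss F H c p (x i) := fun ε =>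
    exists_lt_of_lt_ciSup (sub_lt_self _ hη')
  choose p hp using hex
  set V : (Fin n → Fin K → ℝ) → ℝ := fun σ =>
    ⨆ ε : Fin n → Bool, ∑ i, ∑ j, σ i j * (p ε).1.1 ((p ε).2.1 (x i)) j with hV
  have hcontr := signAvg_iSup_le_integral_iSup_gaussian (n := n) (ι := Fin n → Bool) (fun _ => 0)
    (fun i ε => modelLoss F H c (p ε) (x i)) (fun i ε => (p ε).1.1 ((p ε).2.1 (x i)))
    (L := L) L.2 fun i s t => by
      have := (hL (c (x i))).dist_le_mul ((p s).1.1 ((p s).2.1 (x i))) ((p t).1.1 ((p t).2.1 (x i)))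
      rwa [Real.dist_eq, dist_eq_norm] at this
  simp only [zero_add] at hcontr
  have hVeq : ∀ σ : Fin n → Fin K → ℝ, (⨆ ε : Fin n → Bool, L * √(Real.pi / 2) *
      ∑ i, ∑ j, σ i j * (p ε).1.1 ((p ε).2.1 (x i)) j) = L * √(Real.pi / 2) * V σ := fun σ =>
    (Real.mul_iSup_of_nonneg (by positivity) _).symm
  simp_rw [hVeq] at hcontr
  rw [integral_const_mul] at hcontr
  have hVi : Integrable V (Measure.pi fun _ : Fin n => gaussianVector K) :=
    integrable_iSup_of_finite fun ε => integrable_gaussianSum fun i => (p ε).1.1 ((p ε).2.1 (x i))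
  have hVle : ((∫ σ, V σ ∂(Measure.pi fun _ : Fin n => gaussianVector K) : ℝ) : EReal)
      ≤ sampleComplexity F H x := by
    refine integral_le_expectation hVi fun σ => ?_
    obtain ⟨ε, hε⟩ := exists_eq_ciSup_of_finite
      (f := fun ε : Fin n → Bool => ∑ i, ∑ j, σ i j * (p ε).1.1 ((p ε).2.1 (x i)) j)
    rw [hV]
    beta_reduce
    rw [← hε]
    exact le_iSup (fun p : F × H =>
      ((∑ i, ∑ j, σ i j * p.1.1 (p.2.1 (x i)) j : ℝ) : EReal)) (p ε)
  have hW : signAvg n (fun ε => weightedSup (modelLoss F H c) (fun i => boolSign (ε i)) x)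
      ≤ L * √(Real.pi / 2) * ∫ σ, V σ ∂(Measure.pi fun _ : Fin n => gaussianVector K) + η := by
    calc _ ≤ signAvg n (fun ε => (⨆ ε' : Fin n → Bool,
          ∑ i, boolSign (ε i) * modelLoss F H c (p ε') (x i)) + η) := by
          refine signAvg_mono fun ε => ?_
          have := le_ciSup (f := fun ε' : Fin n → Bool =>
            ∑ i, boolSign (ε i) * modelLoss F H c (p ε') (x i)) (bddAbove_range_of_finite _) ε
          linarith [hp ε]
      _ ≤ _ := by
          rw [signAvg_add, signAvg_const]
          gcongr
  refine (ENNReal.ofReal_le_ofReal hW).trans (ENNReal.ofReal_add_le.trans ?_)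
  rw [ENNReal.ofReal_coe_nnreal, ENNReal.ofReal_mul (by positivity)]
  gcongr
  exact EReal.toENNReal_le_toENNReal hVle

lemma nonneg_of_gaussianComplexity_le {n : ℕ} {B : ℝ}
    (hB : gaussianComplexity n F H PX ≤ (B : EReal)) : 0 ≤ B := by
  rw [gaussianComplexity_eq_lintegral] at hB
  exact_mod_cast (EReal.coe_ennreal_nonneg _).trans hB

/-- The average of the weighted suprema of the losses over fair signs is controlled by the Gaussian
complexity of the models. -/
theorem signAvg_integral_weightedSup_le [IsProbabilityMeasure PX] {M : ℝ}
    (hφ : IsBoundedClass PX (modelLoss F H c) M) {L : ℝ≥0}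
    (hL : ∀ y : Fin K, LipschitzWith L fun v : EuclideanSpace ℝ (Fin K) => crossEntropy v y)
    {n : ℕ} {B : ℝ} (hB : gaussianComplexity n F H PX ≤ (B : EReal)) :
    signAvg n (fun ε => ∫ x, weightedSup (modelLoss F H c) (fun i => boolSign (ε i)) x
      ∂(Measure.pi fun _ => PX)) ≤ L * √(Real.pi / 2) * B := by
  have hB0 := nonneg_of_gaussianComplexity_le hB
  have hint : ∀ ε : Fin n → Bool, Integrable
      (weightedSup (modelLoss F H c) fun i => boolSign (ε i)) (Measure.pi fun _ => PX) :=
    fun ε => hφ.integrable _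
  rw [← integral_signAvg hint]
  rw [gaussianComplexity_eq_lintegral] at hB
  have hB' : ∫⁻ x : Fin n → EuclideanSpace ℝ (Fin d₁), (sampleComplexity F H x).toENNReal
      ∂(Measure.pi fun _ => PX) ≤ ENNReal.ofReal B := by
    have := EReal.toENNReal_le_toENNReal hB
    rwa [EReal.toENNReal_coe, EReal.real_coe_toENNReal] at this
  have hlint : ∫⁻ x, ENNReal.ofReal (signAvg n fun ε =>
        weightedSup (modelLoss F H c) (fun i => boolSign (ε i)) x) ∂(Measure.pi fun _ => PX)
      ≤ ENNReal.ofReal (L * √(Real.pi / 2) * B) := by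
    rw [ENNReal.ofReal_mul (by positivity)]
    calc _ ≤ ∫⁻ x : Fin n → EuclideanSpace ℝ (Fin d₁), ENNReal.ofReal (L * √(Real.pi / 2)) *
          (sampleComplexity F H x).toENNReal ∂(Measure.pi fun _ => PX) :=
          lintegral_mono fun x => signAvg_weightedSup_le_sampleComplexity hL x
      _ ≤ _ := by
          rw [lintegral_const_mul' _ _ ENNReal.ofReal_ne_top]
          gcongr
  rw [integral_eq_lintegral_pos_part_sub_lintegral_neg_part (integrable_signAvg hint)]
  exact (sub_le_self _ ENNReal.toReal_nonneg).trans
    (ENNReal.toReal_le_of_le_ofReal (by positivity) hlint)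

end Model

/-! ### Pre-training error of empirical risk minimizers -/

section Pretraining

variable {d₁ d₂ K : ℕ} {F : Set (EuclideanSpace ℝ (Fin d₂) → EuclideanSpace ℝ (Fin K))}
  {H : Set (EuclideanSpace ℝ (Fin d₁) → EuclideanSpace ℝ (Fin d₂))}
  {PX : Measure (EuclideanSpace ℝ (Fin d₁))} [IsProbabilityMeasure PX]
  {c : EuclideanSpace ℝ (Fin d₁) → Fin K}

lemma lintegral_totalLoss_eq (hmeas : IsMeasurableClass F H PX c) {M : ℝ}
    (hM : ∀ i : Fin K, ∀ f ∈ F, ∀ h ∈ H, ∀ x, crossEntropy (f (h x)) i ≤ M) {N : ℕ} (hN : 0 < N)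
    (p : F × H) :
    ∫⁻ S : Dataset d₁ K N, ENNReal.ofReal (totalLoss p.1.1 p.2.1 S / N)
        ∂(Measure.pi fun _ => clusterLaw PX c)
      = ENNReal.ofReal (∫ x, modelLoss F H c p x ∂PX) := by
  have hc : Measurable fun x => (x, c x) := measurable_id.prodMk hmeas.measurable_clustering
  have : IsProbabilityMeasure (clusterLaw PX c) :=
    Measure.isProbabilityMeasure_map hc.aemeasurable
  set l : EuclideanSpace ℝ (Fin d₁) × Fin K → ℝ := fun z => crossEntropy (p.1.1 (p.2.1 z.1)) z.2
    with hl
  have hlm : Measurable l := measurable_crossEntropy.comp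
    ((((hmeas.measurable_classifier _ p.1.2).comp (hmeas.measurable_extractor _ p.2.2)).comp
      measurable_fst).prodMk measurable_snd)
  have hli : Integrable l (clusterLaw PX c) :=
    Integrable.of_bound hlm.aestronglyMeasurable M (ae_of_all _ fun z => by
      rw [Real.norm_of_nonneg (crossEntropy_nonneg _ _)]
      exact hM _ _ p.1.2 _ p.2.2 _)
  have hlS : ∀ i : Fin N, Integrable (fun S : Dataset d₁ K N => l (S i))
      (Measure.pi fun _ => clusterLaw PX c) := fun i =>
    integrable_comp_eval (μ := fun _ : Fin N => clusterLaw PX c) hli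
  have hlint : ∫ z, l z ∂(clusterLaw PX c) = ∫ x, modelLoss F H c p x ∂PX :=
    integral_map hc.aemeasurable hlm.aestronglyMeasurable
  have htot : Integrable (fun S : Dataset d₁ K N => totalLoss p.1.1 p.2.1 S / N)
      (Measure.pi fun _ => clusterLaw PX c) :=
    (integrable_finsetSum _ fun i _ => hlS i).div_const _
  rw [← ofReal_integral_eq_lintegral_ofReal htot (ae_of_all _ fun S =>
    div_nonneg (Finset.sum_nonneg fun i _ => crossEntropy_nonneg _ _) N.cast_nonneg)]
  congr 1
  rw [integral_div]
  change (∫ S : Dataset d₁ K N, ∑ i, l (S i) ∂(Measure.pi fun _ => clusterLaw PX c)) / N = _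
  rw [integral_finsetSum _ fun i _ => hlS i]
  have heval : ∀ i : Fin N, ∫ S : Dataset d₁ K N, l (S i) ∂(Measure.pi fun _ => clusterLaw PX c)
      = ∫ x, modelLoss F H c p x ∂PX := fun i => by
    rw [← hlint, integral_comp_eval (μ := fun _ : Fin N => clusterLaw PX c)
      hlm.aestronglyMeasurable]
  simp only [heval, Finset.sum_const, Finset.card_univ, Fintype.card_fin, nsmul_eq_mul]
  have : (N : ℝ) ≠ 0 := by positivity
  field_simp

lemma pretrainError_le_of_integral_le (hmeas : IsMeasurableClass F H PX c) {M : ℝ}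
    (hM : ∀ i : Fin K, ∀ f ∈ F, ∀ h ∈ H, ∀ x, crossEntropy (f (h x)) i ≤ M) {N : ℕ} (hN : 0 < N)
    (p : F × H) {B : ℝ}
    (hB : ∀ q, ∫ x, modelLoss F H c p x ∂PX ≤ ∫ x, modelLoss F H c q x ∂PX + B) :
    pretrainError N F H (clusterLaw PX c) p.2.1 ≤ ENNReal.ofReal B := by
  rw [pretrainError, tsub_le_iff_left, ← tsub_le_iff_right]
  refine le_iInf₂ fun h hh => le_iInf₂ fun f hf => ?_
  rw [lintegral_totalLoss_eq hmeas hM hN (⟨f, hf⟩, ⟨h, hh⟩), tsub_le_iff_right]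
  refine (iInf₂_le p.1.1 p.1.2).trans ?_
  rw [lintegral_totalLoss_eq hmeas hM hN p]
  exact (ENNReal.ofReal_le_ofReal (hB _)).trans ENNReal.ofReal_add_le

/-- An empirical risk minimiser has a classifier that is nearly optimal on the sample. -/
lemma IsERM.exists_sum_modelLoss_le {N : ℕ} {x : Fin N → EuclideanSpace ℝ (Fin d₁)}
    {h : EuclideanSpace ℝ (Fin d₁) → EuclideanSpace ℝ (Fin d₂)} [Nonempty F]
    (hERM : IsERM F H (clusterDataset c x) h) (q : F × H) {η : ℝ} (hη : 0 < η) :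
    ∃ f : F, ∑ i, modelLoss F H c (f, ⟨h, hERM.1⟩) (x i) ≤ ∑ i, modelLoss F H c q (x i) + η := by
  obtain ⟨f, hf⟩ := exists_lt_of_ciInf_lt
    (lt_add_of_pos_right (⨅ f : F, totalLoss f.1 h (clusterDataset c x)) hη)
  refine ⟨f, hf.le.trans ?_⟩
  gcongr
  refine (isMinOn_iff.1 hERM.2 q.2.1 q.2.2).trans (ciInf_le ?_ q.1)
  exact ⟨0, by
    rintro _ ⟨f, rfl⟩
    exact Finset.sum_nonneg fun i _ => crossEntropy_nonneg _ _⟩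

/-- After clearing √N, the Gaussian parts compare through π ≤ 4 and the M parts through log(1/δ) <
log(2/δ). Strictness leaves room for near-minimizers. -/
lemma deviation_lt_bound {M G L δ : ℝ} {N : ℕ} (hM : 0 < M) (hG : 0 ≤ G) (hL : 0 ≤ L)
    (hN : 0 < N) (hδ₀ : 0 < δ) (hδ₁ : δ < 1) :
    (L * √(Real.pi / 2) * (G * √((N + N : ℕ) : ℝ)) + M * √((N + N : ℕ) : ℝ) / 2) / N
        + 2 * M / N * √(((N + N : ℕ) : ℝ) * Real.log (1 / δ) / 2)
      < 5 * M * √(Real.log (2 / δ) / (2 * N)) + 2 * G * L / √N := by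
  have hN' : (0 : ℝ) < N := by exact_mod_cast hN
  have hlog : 0 < Real.log (1 / δ) := Real.log_pos ((one_lt_div hδ₀).2 hδ₁)
  have hlog2 : Real.log (2 / δ) = Real.log 2 + Real.log (1 / δ) := by
    rw [← Real.log_mul (by norm_num) (by positivity)]
    ring_nf
  have hl2 := Real.log_two_gt_d9
  set s := √(N : ℝ) with hs
  set t := √(2 : ℝ) with ht
  set r := √(Real.log (1 / δ)) with hr
  set q := √(Real.log (2 / δ)) with hq
  have hs0 : 0 < s := Real.sqrt_pos.2 hN'
  have hss : s * s = N := Real.mul_self_sqrt hN'.le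
  have htt : t * t = 2 := Real.mul_self_sqrt (by norm_num)
  have ht0 : 0 < t := Real.sqrt_pos.2 (by norm_num)
  have ht1 : t < 1.415 := (Real.sqrt_lt' (by norm_num)).2 (by norm_num)
  have hrq : r ≤ q := Real.sqrt_le_sqrt (by linarith)
  -- Since log 2 > 0.64, this holds uniformly in δ, and it absorbs the symmetrization term even as δ
  -- tends to 1.
  have hq8 : 0.8 < q := Real.lt_sqrt_of_sq_lt (by rw [hlog2]; norm_num at *; linarith)
  have h2N : √((N + N : ℕ) : ℝ) = t * s := by
    rw [ht, hs, ← Real.sqrt_mul (by norm_num)]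
    push_cast
    ring_nf
  have h3 : √(((N + N : ℕ) : ℝ) * Real.log (1 / δ) / 2) = s * r := by
    rw [hs, hr, ← Real.sqrt_mul hN'.le]
    push_cast
    ring_nf
  have h4 : √(Real.log (2 / δ) / (2 * N)) = q / (t * s) := by
    rw [Real.sqrt_div' _ (by positivity), Real.sqrt_mul (by norm_num)]
  have hpi : √(Real.pi / 2) ≤ t := Real.sqrt_le_sqrt (by linarith [Real.pi_le_four])
  rw [h2N, h3, h4]
  have hmain : L * √(Real.pi / 2) * (G * t) + M * t / 2 + 2 * M * r
      < 5 * M * q * t / 2 + 2 * G * L := by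
    have h5 : L * √(Real.pi / 2) * (G * t) ≤ 2 * G * L := by
      calc L * √(Real.pi / 2) * (G * t) ≤ L * t * (G * t) := by gcongr
        _ = G * L * (t * t) := by ring
        _ = 2 * G * L := by rw [htt]; ring
    have h6 : t / 2 + 2 * r < 5 * q * t / 2 := by
      nlinarith
    nlinarith
  have e1 : (L * √(Real.pi / 2) * (G * (t * s)) + M * (t * s) / 2) / N + 2 * M / N * (s * r)
      = (L * √(Real.pi / 2) * (G * t) + M * t / 2 + 2 * M * r) / s := by
    rw [← hss]
    field_simp
  have e2 : 5 * M * (q / (t * s)) + 2 * G * L / s = (5 * M * q * t / 2 + 2 * G * L) / s := by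
    rw [← htt]
    field_simp
  rw [e1, e2]
  gcongr

/-- With high probability, the pre-training representation error of every empirical risk minimiser
is small. -/
theorem exists_measurableSet_pretrainError_le {N : ℕ} (hN : 0 < N) (hF : F.Nonempty)
    (hH : H.Nonempty) (hmeas : IsMeasurableClass F H PX c) {M : ℝ} (hM : 0 < M)
    (hloss : ∀ i : Fin K, ∀ f ∈ F, ∀ h ∈ H, ∀ x, crossEntropy (f (h x)) i ≤ M) {G : ℝ}
    (hG : ∀ n : ℕ, 0 < n → gaussianComplexity n F H PX ≤ ((G * √n : ℝ) : EReal)) {L : ℝ≥0}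
    (hL : ∀ y : Fin K, LipschitzWith L fun v : EuclideanSpace ℝ (Fin K) => crossEntropy v y)
    {δ : ℝ} (hδ₀ : 0 < δ) (hδ₁ : δ < 1) :
    ∃ A : Set (Fin N → EuclideanSpace ℝ (Fin d₁)), MeasurableSet A ∧
      ENNReal.ofReal (1 - δ) ≤ (Measure.pi fun _ => PX) A ∧
      ∀ x ∈ A, ∀ h, IsERM F H (clusterDataset c x) h →
        pretrainError N F H (clusterLaw PX c) h
          ≤ ENNReal.ofReal (5 * M * √(Real.log (2 / δ) / (2 * N)) + 2 * G * L / √N) := by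
  have := hF.to_subtype
  have := hH.to_subtype
  have hN' : (0 : ℝ) < N := by exact_mod_cast hN
  have hφ := hmeas.isBoundedClass hloss
  have hG0 : 0 ≤ G := by simpa using nonneg_of_gaussianComplexity_le (hG 1 one_pos)
  have hgap := deviation_lt_bound hM hG0 L.2 hN hδ₀ hδ₁
  set D := (L * √(Real.pi / 2) * (G * √((N + N : ℕ) : ℝ)) + M * √((N + N : ℕ) : ℝ) / 2) / N
        + 2 * M / N * √(((N + N : ℕ) : ℝ) * Real.log (1 / δ) / 2) with hD
  set B := 5 * M * √(Real.log (2 / δ) / (2 * N)) + 2 * G * L / √N with hB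
  change D < B at hgap
  -- The gap B - D is split evenly: half for the near-optimal reference model `q`, half for the
  -- near-optimal classifier of the empirical minimizer.
  obtain ⟨q, hq⟩ := exists_lt_of_ciInf_lt
    (lt_add_of_pos_right (⨅ p, ∫ x, modelLoss F H c p x ∂PX) (half_pos (sub_pos.2 hgap)))
  have hbdd : BddBelow (Set.range fun p => ∫ x, modelLoss F H c p x ∂PX) := ⟨0, by
    rintro _ ⟨p, rfl⟩
    exact integral_nonneg fun x => hφ.nonneg p x⟩
  obtain ⟨A, hA, hAδ, hAle⟩ := hφ.exists_measurableSet_excess_le hM hN q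
    -- The complexity assumption is used at sample size 2N, hence its uniformity in n.
    (signAvg_integral_weightedSup_le hφ hL (hG (N + N) (by omega))) hδ₀ hδ₁
  refine ⟨A, hA, hAδ, fun x hx h hERM => ?_⟩
  obtain ⟨f, hf⟩ := hERM.exists_sum_modelLoss_le q
    (mul_pos (half_pos (sub_pos.2 hgap)) hN')
  refine pretrainError_le_of_integral_le hmeas hloss hN (f, ⟨h, hERM.1⟩) fun p => ?_
  have h1 := hAle x hx (f, ⟨h, hERM.1⟩)
  have h2 : (∑ i, modelLoss F H c (f, ⟨h, hERM.1⟩) (x i) - ∑ i, modelLoss F H c q (x i)) / N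
      ≤ (B - D) / 2 := by
    rw [div_le_iff₀ hN']
    linarith
  have h3 := ciInf_le hbdd p
  rw [add_assoc, ← hD] at h1
  linarith

end Pretraining

end PretrainDiversity

/-! ### Transfer to the downstream task -/

theorem theorem2
    {d₁ d₂ K Kd N Nd : ℕ} (hN : 0 < N)
    -- pre-training classifiers, feature extractors, downstream classifiers
    (F : Set (EuclideanSpace ℝ (Fin d₂) → EuclideanSpace ℝ (Fin K)))
    (H : Set (EuclideanSpace ℝ (Fin d₁) → EuclideanSpace ℝ (Fin d₂)))
    (Fd : Set (EuclideanSpace ℝ (Fin d₂) → EuclideanSpace ℝ (Fin Kd)))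
    (hF : F.Nonempty) (hH : H.Nonempty) (hFd : ∀ f ∈ Fd, Measurable f)
    -- the law of the inputs, the clustering rule, the law of a downstream example
    (PX : Measure (EuclideanSpace ℝ (Fin d₁))) [IsProbabilityMeasure PX]
    (c : EuclideanSpace ℝ (Fin d₁) → Fin K)
    (hmeas : IsMeasurableClass F H PX c)
    (Pd : Measure (EuclideanSpace ℝ (Fin d₁) × Fin Kd)) [IsProbabilityMeasure Pd]
    -- complexity assumption, and the Lipschitz constant of the loss
    (M : ℝ) (hM : 0 < M)
    (hloss : ∀ i : Fin K, ∀ f ∈ F, ∀ h ∈ H, ∀ x, crossEntropy (f (h x)) i ≤ M)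
    (G : ℝ)
    (hG : ∀ n : ℕ, 0 < n → gaussianComplexity n F H PX ≤ ((G * √n : ℝ) : EReal))
    (L : ℝ≥0)
    (hL : ∀ y : Fin K, LipschitzWith L fun v : EuclideanSpace ℝ (Fin K) => crossEntropy v y)
    -- transfer assumption
    (ν₀ ν₁ : ℝ≥0)
    (htransfer : ∀ h ∈ H, downstreamError Nd Fd H Pd h
      ≤ ν₁ * pretrainError N F H (clusterLaw PX c) h + ν₀)
    (ν₀X ν₁X C₀ C₁ : ℝ)
    (hν₀ : |(ν₀ : ℝ) - ν₀X| ≤ C₀ / √K) (hν₁ : |(ν₁ : ℝ) - ν₁X| ≤ C₁ / √K)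
    (δ : ℝ) (hδ₀ : 0 < δ) (hδ₁ : δ < 1) :
    (∃ A : Set (Fin N → EuclideanSpace ℝ (Fin d₁)), MeasurableSet A ∧
      ENNReal.ofReal (1 - δ) ≤ (Measure.pi fun _ => PX) A ∧
      ∀ x ∈ A, ∀ h, IsERM F H (clusterDataset c x) h →
        downstreamError Nd Fd H Pd h
          ≤ ENNReal.ofReal (errorBound ν₀X ν₁X C₀ C₁ M L G δ N K)) ∧
    AntitoneOn (fun k : ℕ => errorBound ν₀X ν₁X C₀ C₁ M L G δ N k) (Set.Ici 1) := by

  -- The clustering rule takes a value in `Fin K`, so K ≥ 1. The two closeness bounds then force C₀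
  -- and C₁ to be nonnegative, which is what monotonicity in K needs.
  have hK : 0 < K := (c 0).pos
  have hK' : (0 : ℝ) < √(K : ℝ) := Real.sqrt_pos.2 (by exact_mod_cast hK)
  have hC₀ : 0 ≤ C₀ := by
    have := (abs_nonneg _).trans hν₀
    rwa [le_div_iff₀ hK', zero_mul] at this
  have hC₁ : 0 ≤ C₁ := by
    have := (abs_nonneg _).trans hν₁
    rwa [le_div_iff₀ hK', zero_mul] at this
  have hG0 : 0 ≤ G := by
    have := hF.to_subtype
    have := hH.to_subtype
    simpa using nonneg_of_gaussianComplexity_le (hG 1 one_pos)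
  have hB : 0 ≤ 5 * M * √(Real.log (2 / δ) / (2 * N)) + 2 * G * L / √N := by positivity
  refine ⟨?_, fun a ha b _ hab => ?_⟩
  · obtain ⟨A, hA, hAδ, hAle⟩ :=
      exists_measurableSet_pretrainError_le hN hF hH hmeas hM hloss hG hL hδ₀ hδ₁
    refine ⟨A, hA, hAδ, fun x hx h hERM => (htransfer h hERM.1).trans ?_⟩
    calc (ν₁ : ℝ≥0∞) * pretrainError N F H (clusterLaw PX c) h + ν₀
        ≤ ν₁ * ENNReal.ofReal (5 * M * √(Real.log (2 / δ) / (2 * N)) + 2 * G * L / √N) + ν₀ := by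
          gcongr
          exact hAle x hx h hERM
      _ = ENNReal.ofReal
          (ν₁ * (5 * M * √(Real.log (2 / δ) / (2 * N)) + 2 * G * L / √N) + ν₀) := by
          rw [ENNReal.ofReal_add (by positivity) ν₀.coe_nonneg, ENNReal.ofReal_mul ν₁.coe_nonneg,
            ENNReal.ofReal_coe_nnreal, ENNReal.ofReal_coe_nnreal]
      _ ≤ _ := by
          refine ENNReal.ofReal_le_ofReal ?_
          rw [errorBound, add_assoc _ ν₀X]
          have h0 := (abs_le.1 hν₀).2
          have h1 := (abs_le.1 hν₁).2
          refine add_le_add (mul_le_mul_of_nonneg_right ?_ hB) ?_ <;> linarith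
  · have ha' : (0 : ℝ) < √(a : ℝ) := Real.sqrt_pos.2 (by exact_mod_cast ha)
    have hab' : √(a : ℝ) ≤ √(b : ℝ) := Real.sqrt_le_sqrt (by exact_mod_cast hab)
    dsimp only [errorBound]
    gcongr
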